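/- Work in $\mathrm{PG}(2,2^h)$ with homogeneous coordinates $(x,y,z)$; an automorphism of the plane is an element of $\mathrm{P\Gamma L}(3,2^h)$, that is, a map $v\mapsto Av^{\sigma}$ with $A$ an invertible matrix and $\sigma$ a field automorphism (its companion). A maximal arc of degree $d$ is a non-empty proper set of points meeting every line in $0$ or $d$ points. Let $\mathcal F$ be the set of conics $F_{\alpha,\beta,\lambda}:\alpha x^2+xy+\beta y^2+\lambda z^2=0$ with $\mathrm{Tr}(\alpha\beta)=1$ and $\lambda\ne0$, where $\mathrm{Tr}$ is the absolute trace. A set $\mathcal C\subset\mathcal F$ is closed if any two distinct $F_{\alpha,\beta,\lambda},F_{\alpha',\beta',\lambda'}\in\mathcal C$ have $\lambda\neq\lambda'$ and $$F_{\frac{\alpha\lambda+\alpha'\lambda'}{\lambda+\lambda'},\,\frac{\beta\lambda+\beta'\lambda'}{\lambda+\lambda'},\,\lambda+\lambda'}\in\mathcal C .$$ A Mathon $8$-arc is a maximal arc of degree $8$ that is the image, under an automorphism of the plane, of the union of $\{(0,0,1)\}$ and the $7$ conics of a closed set $\mathcal C$ with $|\mathcal C|=7$; its conics are the images of these $7$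 conics. It is of Denniston type if it is isomorphic (i.e. equivalent under an automorphism of the plane) to the union of $(0,0,1)$ and the conics $F_{\alpha,1,\lambda}$, $\lambda\in A\setminus\{0\}$, for some fixed $\alpha$ with $\mathrm{Tr}(\alpha)=1$ and some additive subgroup $A$ of $\mathrm{GF}(2^h)$. Let $h$ be odd and divisible by $7$, and regard $\mathrm{GF}(2^7)$ as a subfield of $\mathrm{GF}(2^h)$. For a primitive element $a$ of $\mathrm{GF}(2^7)$ consider the set $$\mathcal K=\bigcup_{(i,j)}\{(x,y,z): a^ix^2+xy+y^2+a^jz^2=0\}\cup\{(0,0,1)\}$$ in $\mathrm{PG}(2,2^h)$, where either 1. $1+a+a^7=0$ and $(i,j)$ runs over $(0,0),(0,-1),(0,6),(16,2),(39,14),(93,62),(101,30)$; or 2. $1+a^3+a^7=0$ and $(i,j)$ runs over $(0,0),(0,-1),(0,30),(18,2),(12,62),(33,6),(43,14)$. Such elements $a$ exist in both cases. Up to isomorphism $\mathcal K$ depends only on the case and not on the choice of $a$, and arcs from the two cases are not isomorphic; so there are two infinite families. In both cases $\mathcal K$ is a Mathon $8$-arc whose conics are the seven given ones, and it is not of Denniston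 type. Moreover: * If $49\nmid h$, there is an automorphism $\tau$ of $\mathrm{GF}(2^h)$ of order $7$ that acts as squaring on $\mathrm{GF}(2^7)$, and there is an automorphism $\theta$ of the plane with companion $\tau$, of order $7$, such that the cyclic group $\langle\theta\rangle$ stabilises $\mathcal K$ and acts sharply transitively on its $7$ conics. * If $49\mid h$ ("Singer $8$-arcs of the second kind"), then automorphisms of $\mathrm{GF}(2^h)$ acting as squaring on $\mathrm{GF}(2^7)$ exist, and every such $\tau$ has order divisible by $49$ (in particular, not $7$). For every such $\tau$ there is an automorphism $\theta$ of the plane with companion $\tau$ such that the cyclic group $\langle\theta\rangle$ stabilises $\mathcal K$ and acts transitively on its $7$ conics; it has a unique subgroup of order $7$, and every element of this subgroup stabilises each of the $7$ conics, but no non-identity element of it fixes any of the conics pointwise. However, no group of automorphisms of the plane that stabilises $\mathcal K$ and permutes its conics acts sharply transitively on the $7$ conics. -/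

import Mathlib

open scoped LinearAlgebra.Projectivization

namespace MathonArcs

/-- The points of `PG(2, K)`. -/
abbrev Point (K : Type*) [Field K] : Type _ := ℙ K (Fin 3 → K)

/-- The line `[u, v, w]` of `PG(2, K)`: all points `(a, b, c)` with `a u + b v + c w = 0`. -/
def line {K : Type*} [Field K] (u : Fin 3 → K) : Set (Point K) :=
  {p | ∑ i, p.rep i * u i = 0}

/-- `g` is an automorphism of `PG(2, K)` of the form `x ↦ f (x)`, where `f` is semilinear with
companion field automorphism `σ` (that is, `x ↦ A x ^ σ` with `A` an invertible matrix). -/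
def IsCollineationWith {K : Type*} [Field K] (σ : RingAut K) (g : Equiv.Perm (Point K)) : Prop :=
  ∃ (f : (Fin 3 → K) →ₛₗ[(σ : K →+* K)] (Fin 3 → K)) (hf : Function.Injective f),
    ∀ p : Point K, g p = Projectivization.map f hf p

/-- `g` is an element of the group `PΓL(3, K)` of automorphisms of `PG(2, K)`. -/
def IsCollineation {K : Type*} [Field K] (g : Equiv.Perm (Point K)) : Prop :=
  ∃ σ : RingAut K, IsCollineationWith σ g

/-- Two point sets are isomorphic if an automorphism of the plane maps one onto the other. -/
def Isomorphic {K : Type*} [Field K] (S T : Set (Point K)) : Prop :=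
  ∃ g : Equiv.Perm (Point K), IsCollineation g ∧ g '' S = T

/-- A maximal arc of degree `d`: a non-empty proper set of points such that every line meets it
in `0` or `d` points. -/
def IsMaximalArc {K : Type*} [Field K] (d : ℕ) (S : Set (Point K)) : Prop :=
  S.Nonempty ∧ S ≠ Set.univ ∧
    ∀ u : Fin 3 → K, u ≠ 0 → (S ∩ line u).ncard = 0 ∨ (S ∩ line u).ncard = d

/-- The coefficients of the conic `α x² + x y + β y² + lam z² = 0`. -/
@[ext]
structure Conic (K : Type*) where
  α : K
  β : K
  lam : K

/-- The point set of the conic `α x² + x y + β y² + lam z² = 0`. -/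
def Conic.points {K : Type*} [Field K] (F : Conic K) : Set (Point K) :=
  {p | F.α * p.rep 0 ^ 2 + p.rep 0 * p.rep 1 + F.β * p.rep 1 ^ 2 + F.lam * p.rep 2 ^ 2 = 0}

/-- Membership in the set of conics used in Mathon's construction: `Tr (α β) = 1`, `lam ≠ 0`. -/
def Conic.IsMathon {K : Type*} [Field K] [Algebra (ZMod 2) K] (F : Conic K) : Prop :=
  Algebra.trace (ZMod 2) K (F.α * F.β) = 1 ∧ F.lam ≠ 0

/-- Mathon's composition of two conics (meaningful if their `lam`-coefficients are distinct). -/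
def Conic.comp {K : Type*} [Field K] (F G : Conic K) : Conic K where
  α := (F.α * F.lam + G.α * G.lam) / (F.lam + G.lam)
  β := (F.β * F.lam + G.β * G.lam) / (F.lam + G.lam)
  lam := F.lam + G.lam

/-- A closed set of conics. -/
def IsClosedSet {K : Type*} [Field K] [Algebra (ZMod 2) K] (C : Set (Conic K)) : Prop :=
  (∀ F ∈ C, F.IsMathon) ∧
    ∀ F ∈ C, ∀ G ∈ C, F ≠ G → F.lam ≠ G.lam ∧ F.comp G ∈ C

/-- The point `(0, 0, 1)`. -/
def nucleus (K : Type*) [Field K] : Point K :=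
  Projectivization.mk K ![0, 0, 1] (fun h => one_ne_zero (congrFun h 2))

/-- The set of all (point sets of) conics with coefficients in `C`. -/
def conics {K : Type*} [Field K] (C : Set (Conic K)) : Set (Set (Point K)) :=
  Conic.points '' C

/-- The union of all conics with coefficients in `C`, together with the point `(0, 0, 1)`. -/
def arc {K : Type*} [Field K] (C : Set (Conic K)) : Set (Point K) :=
  ⋃₀ conics C ∪ {nucleus K}

/-- `S` is a maximal arc of degree `d` of Mathon type with set of conics `𝒦`: it is isomorphic to
the arc obtained from a closed set `C` of `d - 1` conics, and `𝒦` corresponds to `C`. -/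
def IsMathonArc {K : Type*} [Field K] [Algebra (ZMod 2) K] (d : ℕ) (S : Set (Point K))
    (𝒦 : Set (Set (Point K))) : Prop :=
  IsMaximalArc d S ∧ 𝒦.ncard + 1 = d ∧
    ∃ C : Set (Conic K), IsClosedSet C ∧ C.ncard + 1 = d ∧
      ∃ g : Equiv.Perm (Point K), IsCollineation g ∧ S = g '' arc C ∧
        𝒦 = (fun X : Set (Point K) => g '' X) '' conics C

/-- `S` is of Denniston type: it is isomorphic to the union of `(0, 0, 1)` and the conics
`α x² + x y + y² + lam z² = 0`, `lam ∈ A \ {0}`, for a fixed `α` of trace `1` and an additive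
subgroup `A` of `K`. -/
def IsDennistonType {K : Type*} [Field K] [Algebra (ZMod 2) K] (S : Set (Point K)) : Prop :=
  ∃ (α : K) (A : AddSubgroup K), Algebra.trace (ZMod 2) K α = 1 ∧
    Isomorphic (arc {F : Conic K | F.α = α ∧ F.β = 1 ∧ F.lam ∈ A ∧ F.lam ≠ 0}) S

/-- `G` is a group of automorphisms of the plane which stabilises the point set `S` and permutes
the members of `𝒦`. -/
def IsAutGroup {K : Type*} [Field K] (G : Subgroup (Equiv.Perm (Point K))) (S : Set (Point K))
    (𝒦 : Set (Set (Point K))) : Prop :=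
  ∀ g ∈ G, IsCollineation g ∧ g '' S = S ∧ ∀ X ∈ 𝒦, g '' X ∈ 𝒦

/-- `G` acts transitively on `𝒦`. -/
def Transitive {K : Type*} [Field K] (G : Subgroup (Equiv.Perm (Point K)))
    (𝒦 : Set (Set (Point K))) : Prop :=
  ∀ X ∈ 𝒦, ∀ Y ∈ 𝒦, ∃ g ∈ G, g '' X = Y

/-- `G` acts sharply transitively on `𝒦`. -/
def SharplyTransitive {K : Type*} [Field K] (G : Subgroup (Equiv.Perm (Point K)))
    (𝒦 : Set (Set (Point K))) : Prop :=
  ∀ X ∈ 𝒦, ∀ Y ∈ 𝒦, ∃! g : Equiv.Perm (Point K), g ∈ G ∧ g '' X = Y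

/-- The conics `a ^ i x² + x y + y² + a ^ j z² = 0` for the exponent pairs `(i, j)` in `e`. -/
def conicsWithExponents {K : Type*} [Field K] (a : K) (e : List (ℤ × ℤ)) : Set (Conic K) :=
  {F | ∃ ij ∈ e, F = ⟨a ^ ij.1, 1, a ^ ij.2⟩}

/-- The seven conics of the first Singer arc, where `1 + a + a ^ 7 = 0`. -/
def singerConics₁ {K : Type*} [Field K] (a : K) : Set (Conic K) :=
  conicsWithExponents a
    [(0, 0), (0, -1), (0, 6), (16, 2), (39, 14), (93, 62), (101, 30)]

/-- The seven conics of the second Singer arc, where `1 + a ^ 3 + a ^ 7 = 0`. -/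
def singerConics₂ {K : Type*} [Field K] (a : K) : Set (Conic K) :=
  conicsWithExponents a
    [(0, 0), (0, -1), (0, 30), (18, 2), (12, 62), (33, 6), (43, 14)]

/-- `τ` acts as squaring on the subfield of order `2 ^ 7`, whose elements are the `x` with
`x ^ 2 ^ 7 = x`. -/
def ActsAsSquaring {K : Type*} [Field K] (τ : RingAut K) : Prop :=
  ∀ x : K, x ^ 2 ^ 7 = x → τ x = x ^ 2

end MathonArcs

namespace MathonArcs

/-! ### Frobenius, automorphisms and trace of GF(2^h) -/

section FiniteField

variable {K : Type*} [Field K]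

/-! For k = 1 or 3, multiplying 1 + X^k + X^7 by X gives the additive polynomial X + X^(k+1) + X^8.
Hence its seven roots together with 0 form an additive group (`add_mem_singerRoots`), and squaring
permutes the roots in one cycle. A shear turns each of the two given arcs into the conics (1 +
X^3)x^2 + xy + y^2 + Xz^2 = 0, with X running over these roots (`exists_coordinate_change`). All
coefficients are now polynomials in X over GF(2), so a field automorphism τ that squares the
elements of GF(2^7), applied to the coordinates, sends the conic of X to that of X^2. This is the
generator θ, and its order is that of τ.

The conics form a closed set because X(1 + X^3) is additive in X, and the trace condition holds
because Tr(X^3) = 0 and h is odd. On a line off (0,0,1), whether a conic has two points or none is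
decided by a trace that is, up to a constant, additive in X. An additive map to GF(2) takes the
value 1 at 0 or 4 of the seven roots, so the line meets the arc in 0 or 8 points.

The negative statements rest on rigidity (`exists_conic_eq_image`). Distinct conics share at most
four points and the field has at least 128 elements, so a collineation between such arcs maps conics
to conics, fixes (0,0,1), and acts on the z^2-coefficients as X ↦ e σ(X) with e constant. A
polynomial of degree at most 3 that vanishes at the seven roots is zero (`cubic_eq_zero`). This
separates the two families, excludes Denniston type (the x^2-coefficient would have to be constant,
but it is cubic in X), and forces e = 1 if σ is trivial on GF(2^7). If 49 divides h, then σ^7 = 1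
implies this triviality, so a collineation with seventh power 1 that stabilises the arc fixes every
conic. A sharply transitive group would have order 7, which is therefore impossible. -/

theorem charP_two (K : Type*) [Field K] [Algebra (ZMod 2) K] : CharP K 2 :=
  charP_of_injective_algebraMap (algebraMap (ZMod 2) K).injective 2

theorem finrank_eq [Finite K] [Algebra (ZMod 2) K] {h : ℕ} (hcard : Nat.card K = 2 ^ h) :
    Module.finrank (ZMod 2) K = h := by
  have := Module.natCard_eq_pow_finrank (K := ZMod 2) (V := K)
  rw [hcard, Nat.card_zmod] at this
  exact (Nat.pow_right_injective le_rfl this).symm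

theorem frobeniusAlgHom_pow_apply [Algebra (ZMod 2) K] (m : ℕ) (x : K) :
    (FiniteField.frobeniusAlgHom (ZMod 2) K ^ m) x = x ^ 2 ^ m := by
  rw [AlgHom.coe_pow, FiniteField.coe_frobeniusAlgHom, pow_iterate, ZMod.card]

theorem forall_pow_two_pow_eq_self_iff [Finite K] [Algebra (ZMod 2) K] {h : ℕ}
    (hcard : Nat.card K = 2 ^ h) (m : ℕ) : (∀ x : K, x ^ 2 ^ m = x) ↔ h ∣ m := by
  rw [← finrank_eq hcard, ← FiniteField.orderOf_frobeniusAlgHom, orderOf_dvd_iff_pow_eq_one,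
    AlgHom.ext_iff]
  simp [frobeniusAlgHom_pow_apply]

/-- A ring automorphism fixes the prime field, and the powers of Frobenius exhaust the automorphisms
over it. Orders of companions thereby become divisibility questions about the exponent j. -/
theorem exists_ringAut_eq_pow [Finite K] [Algebra (ZMod 2) K] (σ : RingAut K) :
    ∃ j : ℕ, ∀ x, σ x = x ^ 2 ^ j := by
  let f : K →ₐ[ZMod 2] K :=
    { (σ : K →+* K) with
      commutes' := fun r => RingHom.congr_fun
        (RingHom.ext_zmod ((σ : K →+* K).comp (algebraMap (ZMod 2) K)) (algebraMap (ZMod 2) K)) r }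
  obtain ⟨n, hn⟩ := (FiniteField.bijective_frobeniusAlgHom_pow (ZMod 2) K).2 f
  exact ⟨n, fun x => (DFunLike.congr_fun hn x).symm.trans (frobeniusAlgHom_pow_apply _ _)⟩

theorem exists_ringAut_pow [Finite K] [CharP K 2] (j : ℕ) :
    ∃ σ : RingAut K, ∀ x, σ x = x ^ 2 ^ j := by
  have : ExpChar K 2 := ExpChar.prime Nat.prime_two
  exact ⟨iterateFrobeniusEquiv K 2 j, fun x => by simp [iterateFrobenius_def]⟩

theorem ringAut_pow_apply {σ : RingAut K} {j : ℕ} (hσ : ∀ x, σ x = x ^ 2 ^ j) (n : ℕ) (x : K) :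
    (σ ^ n) x = x ^ 2 ^ (j * n) := by
  induction n generalizing x with
  | zero => simp
  | succ n ih => rw [pow_succ, RingAut.mul_apply, hσ, ih, ← pow_mul, ← pow_add]; ring_nf

theorem ringAut_pow_eq_one_iff [Finite K] [Algebra (ZMod 2) K] {h : ℕ}
    (hcard : Nat.card K = 2 ^ h) {σ : RingAut K} {j : ℕ} (hσ : ∀ x, σ x = x ^ 2 ^ j) (n : ℕ) :
    σ ^ n = 1 ↔ h ∣ j * n := by
  rw [← forall_pow_two_pow_eq_self_iff hcard, RingEquiv.ext_iff]
  simp [ringAut_pow_apply hσ]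

theorem pow_two_pow_eq_self {x : K} {m : ℕ} (hx : x ^ 2 ^ m = x) (n : ℕ) :
    x ^ 2 ^ (m * n) = x := by
  induction n with
  | zero => simp
  | succ n ih => rw [mul_add, mul_one, pow_add, pow_mul, ih, hx]

variable [Finite K] [Algebra (ZMod 2) K]

theorem trace_sq (x : K) : Algebra.trace (ZMod 2) K (x ^ 2) = Algebra.trace (ZMod 2) K x := by
  have := Algebra.trace_eq_of_algEquiv (FiniteField.frobeniusAlgEquivOfAlgebraic (ZMod 2) K) x
  rwa [FiniteField.coe_frobeniusAlgEquivOfAlgebraic, ZMod.card] at this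

theorem trace_sq_add_self (x : K) : Algebra.trace (ZMod 2) K (x ^ 2 + x) = 0 := by
  rw [map_add, trace_sq, CharTwo.add_self_eq_zero]

theorem trace_one {h : ℕ} (hcard : Nat.card K = 2 ^ h) (hodd : Odd h) :
    Algebra.trace (ZMod 2) K 1 = 1 := by
  rw [← map_one (algebraMap (ZMod 2) K), Algebra.trace_algebraMap, finrank_eq hcard]
  obtain ⟨m, rfl⟩ := hodd
  have h2 : (2 : ZMod 2) = 0 := rfl
  simp [h2]

/-- Additive Hilbert 90 by counting: y ↦ y^2 + y has kernel {0, 1}, so its image has index 2. It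
lies in the kernel of the trace, which also has index 2. -/
theorem exists_sq_add_self_eq {t : K} (ht : Algebra.trace (ZMod 2) K t = 0) :
    ∃ y, y ^ 2 + y = t := by
  have := charP_two K
  let f : K →+ K := (frobenius K 2).toAddMonoidHom + AddMonoidHom.id K
  have hf : ∀ x, f x = x ^ 2 + x := fun x => by simp [f, frobenius_def]
  let T : K →+ ZMod 2 := (Algebra.trace (ZMod 2) K).toAddMonoidHom
  have hle : f.range ≤ T.ker := by
    rintro _ ⟨x, rfl⟩
    rw [hf]; exact trace_sq_add_self x
  have hker : Nat.card f.ker = 2 := by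
    have : (f.ker : Set K) = {0, 1} := by
      ext x
      simp only [SetLike.mem_coe, AddMonoidHom.mem_ker, hf, Set.mem_insert_iff,
        Set.mem_singleton_iff]
      have : x ^ 2 + x = x * (x - 1) := by
        linear_combination x * (CharTwo.two_eq_zero : (2 : K) = 0)
      rw [this, mul_eq_zero, sub_eq_zero]
    change Nat.card (f.ker : Set K) = 2
    rw [this, Nat.card_coe_set_eq, Set.ncard_pair zero_ne_one]
  have hT : Nat.card T.range = 2 := by
    have : T.range = ⊤ := AddMonoidHom.range_eq_top.2 (Algebra.trace_surjective (ZMod 2) K)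
    rw [this]; simp
  have h1 := AddSubgroup.card_eq_card_quotient_mul_card_addSubgroup f.ker
  have h2 := AddSubgroup.card_eq_card_quotient_mul_card_addSubgroup T.ker
  rw [Nat.card_congr (QuotientAddGroup.quotientKerEquivRange f).toEquiv, hker] at h1
  rw [Nat.card_congr (QuotientAddGroup.quotientKerEquivRange T).toEquiv, hT] at h2
  have h3 : f.range = T.ker := AddSubgroup.eq_of_le_of_card_ge hle (by omega)
  have h4 : t ∈ f.range := by rw [h3]; exact ht
  obtain ⟨y, hy⟩ := h4
  exact ⟨y, (hf y).symm.trans hy⟩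

end FiniteField

/-! ### The roots of the two trinomials -/

section Roots

/-- The roots of `1 + X ^ k + X ^ 7`. -/
def singerRoots (K : Type*) [Field K] (k : ℕ) : Set K :=
  {x | 1 + x ^ k + x ^ 7 = 0}

variable {K : Type*} [Field K] [CharP K 2] {k : ℕ}

theorem pow_127_eq_one (hk : k = 1 ∨ k = 3) {a : K} (ha : a ∈ singerRoots K k) : a ^ 127 = 1 := by
  rcases hk with rfl | rfl <;> simp only [singerRoots, Set.mem_ofPred_eq] at ha <;> grind

theorem ne_zero_of_mem (hk : k = 1 ∨ k = 3) {a : K} (ha : a ∈ singerRoots K k) : a ≠ 0 := by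
  rintro rfl
  rcases hk with rfl | rfl <;> simp [singerRoots] at ha

theorem ne_one_of_mem {a : K} (ha : a ∈ singerRoots K k) : a ≠ 1 := by
  rintro rfl
  simp [singerRoots, CharTwo.add_self_eq_zero] at ha

theorem pow_128_eq_self (hk : k = 1 ∨ k = 3) {a : K} (ha : a ∈ singerRoots K k) :
    a ^ 2 ^ 7 = a := by
  have := pow_127_eq_one hk ha
  linear_combination a * this

theorem orderOf_eq (hk : k = 1 ∨ k = 3) {a : K} (ha : a ∈ singerRoots K k) : orderOf a = 127 :=
  haveI : Fact (Nat.Prime 127) := ⟨by norm_num⟩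
  orderOf_eq_prime (pow_127_eq_one hk ha) (ne_one_of_mem ha)

theorem sq_mem {a : K} (ha : a ∈ singerRoots K k) : a ^ 2 ∈ singerRoots K k := by
  simp only [singerRoots, Set.mem_ofPred_eq] at ha ⊢
  have : (1 + a ^ k + a ^ 7) ^ 2 = 0 := by rw [ha]; simp
  rw [CharTwo.add_sq, CharTwo.add_sq] at this
  linear_combination this

theorem pow_two_pow_mem {a : K} (ha : a ∈ singerRoots K k) (i : ℕ) :
    a ^ 2 ^ i ∈ singerRoots K k := by
  induction i with
  | zero => simpa
  | succ i ih => rw [pow_succ, pow_mul]; exact sq_mem ih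

open Polynomial in
theorem singerRoots_finite_and_ncard_le (hk : k = 1 ∨ k = 3) :
    (singerRoots K k).Finite ∧ (singerRoots K k).ncard ≤ 7 := by
  classical
  let P : K[X] := 1 + X ^ k + X ^ 7
  have hd : P.natDegree = 7 := by rcases hk with rfl | rfl <;> simp only [P] <;> compute_degree!
  have hP : P ≠ 0 := by intro h0; simp [h0] at hd
  have : singerRoots K k = (P.roots.toFinset : Set K) := by
    ext x; simp [singerRoots, P, hP]
  rw [this, Set.ncard_coe_finset]
  exact ⟨Finset.finite_toSet _, (Multiset.toFinset_card_le _).trans ((card_roots' P).trans hd.le)⟩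

theorem pow_two_pow_injOn (hk : k = 1 ∨ k = 3) {a : K} (ha : a ∈ singerRoots K k) :
    Set.InjOn (fun i : ℕ => a ^ 2 ^ i) (Finset.range 7) := by
  intro i hi j hj hij
  simp only at hij
  rw [← pow_mod_orderOf, ← pow_mod_orderOf (n := 2 ^ j), orderOf_eq hk ha] at hij
  have := pow_injOn_Iio_orderOf (x := a)
    (by rw [orderOf_eq hk ha]; exact Nat.mod_lt _ (by norm_num))
    (by rw [orderOf_eq hk ha]; exact Nat.mod_lt _ (by norm_num)) hij
  simp only [Finset.coe_range, Set.mem_Iio] at hi hj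
  interval_cases i <;> interval_cases j <;> simp_all

theorem singerRoots_eq_image (hk : k = 1 ∨ k = 3) {a : K} (ha : a ∈ singerRoots K k) :
    (fun i : ℕ => a ^ 2 ^ i) '' (Finset.range 7 : Set ℕ) = singerRoots K k := by
  obtain ⟨hf, hc⟩ := singerRoots_finite_and_ncard_le (K := K) hk
  refine Set.eq_of_subset_of_ncard_le ?_ ?_ hf
  · rintro _ ⟨i, -, rfl⟩
    exact pow_two_pow_mem ha i
  · rw [(pow_two_pow_injOn hk ha).ncard_image]
    simpa using hc

theorem singerRoots_ncard (hk : k = 1 ∨ k = 3) {a : K} (ha : a ∈ singerRoots K k) :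
    (singerRoots K k).ncard = 7 := by
  rw [← singerRoots_eq_image hk ha, (pow_two_pow_injOn hk ha).ncard_image]
  simp

theorem exists_eq_pow (hk : k = 1 ∨ k = 3) {a b : K} (ha : a ∈ singerRoots K k)
    (hb : b ∈ singerRoots K k) : ∃ i : ℕ, b = a ^ 2 ^ i := by
  rw [← singerRoots_eq_image hk ha] at hb
  obtain ⟨i, -, rfl⟩ := hb
  exact ⟨i, rfl⟩

/-- Times x, the trinomial is x + x^(k+1) + x^8, which is additive because k + 1 is 2 or 4. Its
value at x + y is therefore 0, and the nonzero factor x + y can be cancelled. -/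
theorem add_mem_singerRoots (hk : k = 1 ∨ k = 3) {x y : K} (hx : x ∈ singerRoots K k)
    (hy : y ∈ singerRoots K k) (hxy : x ≠ y) : x + y ∈ singerRoots K k := by
  have h0 : x + y ≠ 0 := fun h => hxy (by rw [← sub_eq_zero, CharTwo.sub_eq_add, h])
  simp only [singerRoots, Set.mem_ofPred_eq] at hx hy ⊢
  refine (mul_eq_zero.1 ?_).resolve_left h0
  rcases hk with rfl | rfl <;> grind

open Polynomial in
-- Seven roots are too many for degree 3. This lets an identity that holds for all seven conics be
-- compared coefficientwise in X.
theorem cubic_eq_zero (hk : k = 1 ∨ k = 3) {a : K} (ha : a ∈ singerRoots K k) {A B C D : K}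
    (hall : ∀ x ∈ singerRoots K k, A * x ^ 3 + B * x ^ 2 + C * x + D = 0) :
    A = 0 ∧ B = 0 ∧ C = 0 ∧ D = 0 := by
  classical
  let P : Cubic K := ⟨A, B, C, D⟩
  have hP : P.toPoly = 0 := by
    by_contra hne
    have hsub : singerRoots K k ⊆ (P.toPoly.roots.toFinset : Set K) := by
      intro x hx
      rw [Finset.mem_coe, Multiset.mem_toFinset, mem_roots hne]
      simpa [P, Cubic.toPoly, IsRoot] using hall x hx
    have h1 := Set.ncard_le_ncard hsub (Finset.finite_toSet _)
    rw [singerRoots_ncard hk ha, Set.ncard_coe_finset] at h1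
    have h2 := (Multiset.toFinset_card_le P.toPoly.roots).trans (card_roots' _)
    have h3 : P.toPoly.natDegree ≤ 3 := by simp only [Cubic.toPoly]; compute_degree
    omega
  exact ⟨(P.coeff_eq_a).symm.trans (by rw [hP, coeff_zero]), (P.coeff_eq_b).symm.trans (by rw [hP, coeff_zero]),
    (P.coeff_eq_c).symm.trans (by rw [hP, coeff_zero]), (P.coeff_eq_d).symm.trans (by rw [hP, coeff_zero])⟩

/-- Replacing x^7 by 1 + x^k in the trinomial at c x leaves (c^7 + c^k) x^k + (c^7 + 1). Both
coefficients vanish, so c^7 = c^k = 1, and k is prime to 7. -/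
theorem eq_one_of_mul_mem (hk : k = 1 ∨ k = 3) {a c : K} (ha : a ∈ singerRoots K k)
    (hc : ∀ x ∈ singerRoots K k, c * x ∈ singerRoots K k) : c = 1 := by
  rcases hk with rfl | rfl
  · obtain ⟨-, -, h1, h2⟩ := cubic_eq_zero (Or.inl rfl) ha (A := 0) (B := 0) (C := c ^ 7 + c)
      (D := c ^ 7 + 1) fun x hx => by
        have := hc x hx
        simp only [singerRoots, Set.mem_ofPred_eq] at this hx
        grind
    grind
  · obtain ⟨h1, -, -, h2⟩ := cubic_eq_zero (Or.inr rfl) ha (A := c ^ 7 + c ^ 3) (B := 0) (C := 0)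
      (D := c ^ 7 + 1) fun x hx => by
        have := hc x hx
        simp only [singerRoots, Set.mem_ofPred_eq] at this hx
        grind
    grind

theorem not_forall_mul_mem {b : K} (hb : b ∈ singerRoots K 3) (c : K) :
    ¬ ∀ x ∈ singerRoots K 3, c * x ∈ singerRoots K 1 := by
  intro hc
  obtain ⟨h1, -, -, h2⟩ := cubic_eq_zero (Or.inr rfl) hb (A := c ^ 7) (B := 0) (C := c)
    (D := c ^ 7 + 1) fun x hx => by
      have := hc x hx
      simp only [singerRoots, Set.mem_ofPred_eq] at this hx
      grind
  simp [h1] at h2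

theorem trace_pow_three [Finite K] [Algebra (ZMod 2) K] (hk : k = 1 ∨ k = 3) {a : K}
    (ha : a ∈ singerRoots K k) : Algebra.trace (ZMod 2) K (a ^ 3) = 0 := by
  simp only [singerRoots, Set.mem_ofPred_eq] at ha
  rcases hk with rfl | rfl
  -- An explicit y with a^3 = y^2 + y, which makes the trace vanish over every extension of GF(2^7).
  · have : a ^ 3 = (a + a ^ 4 + a ^ 5 + a ^ 6) ^ 2 + (a + a ^ 4 + a ^ 5 + a ^ 6) := by grind
    rw [this, trace_sq_add_self]
  · have : a ^ 3 = (a + a ^ 2 + a ^ 5 + a ^ 6) ^ 2 + (a + a ^ 2 + a ^ 5 + a ^ 6) := by grind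
    rw [this, trace_sq_add_self]

/-- A root b in the algebraic closure satisfies b^128 = b, hence b^|K| = b as 7 divides h. Since
X^|K| - X is the product of X - x over x in K, b lies in K. -/
theorem exists_mem_singerRoots [Finite K] (hk : k = 1 ∨ k = 3) {h : ℕ}
    (hcard : Nat.card K = 2 ^ h) (h7 : 7 ∣ h) : (singerRoots K k).Nonempty := by
  have := Fintype.ofFinite K
  let P : Polynomial (AlgebraicClosure K) := 1 + Polynomial.X ^ k + Polynomial.X ^ 7
  have hd : P.degree ≠ 0 := by
    have : P.degree = 7 := by rcases hk with rfl | rfl <;> simp only [P] <;> compute_degree!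
    rw [this]; norm_num
  obtain ⟨b, hb⟩ := IsAlgClosed.exists_root P hd
  have : CharP (AlgebraicClosure K) 2 :=
    charP_of_injective_algebraMap (algebraMap K (AlgebraicClosure K)).injective 2
  have hb' : b ∈ singerRoots (AlgebraicClosure K) k := by
    change 1 + b ^ k + b ^ 7 = 0
    simpa [P, Polynomial.IsRoot] using hb
  obtain ⟨m, rfl⟩ := h7
  have hq : b ^ Fintype.card K = b := by
    rw [Fintype.card_eq_nat_card, hcard]
    exact pow_two_pow_eq_self (pow_128_eq_self hk hb') m
  have hprod := Polynomial.prod_multiset_X_sub_C_of_monic_of_roots_card_eq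
    (Polynomial.monic_X_pow_sub (n := Fintype.card K) (p := (Polynomial.X : Polynomial K))
      (by rw [Polynomial.degree_X]; exact_mod_cast Fintype.one_lt_card)) (by
      rw [FiniteField.roots_X_pow_card_sub_X,
        FiniteField.X_pow_card_sub_X_natDegree_eq K Fintype.one_lt_card]; rfl)
  replace hprod := congrArg (Polynomial.aeval b) hprod
  rw [FiniteField.roots_X_pow_card_sub_X] at hprod
  simp only [map_sub, map_pow, Polynomial.aeval_X, hq, sub_self, map_multiset_prod,
    Multiset.prod_eq_zero_iff] at hprod
  obtain ⟨x, hx⟩ : ∃ x : K, b - algebraMap K _ x = 0 := by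
    simpa [eq_comm] using hprod
  replace hx := sub_eq_zero.1 hx
  refine ⟨x, (algebraMap K (AlgebraicClosure K)).injective ?_⟩
  have hb'' : 1 + b ^ k + b ^ 7 = 0 := hb'
  simpa [hx] using hb''

end Roots

/-! ### Conics, lines and semilinear maps in coordinates -/

section Collineations

variable {K : Type*} [Field K]

/-- The quadratic form of a conic. -/
def Conic.eval (F : Conic K) (v : Fin 3 → K) : K :=
  F.α * v 0 ^ 2 + v 0 * v 1 + F.β * v 1 ^ 2 + F.lam * v 2 ^ 2

theorem mk_mem_points (F : Conic K) (v : Fin 3 → K) (hv : v ≠ 0) :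
    Projectivization.mk K v hv ∈ F.points ↔ F.eval v = 0 := by
  obtain ⟨a, ha⟩ := Projectivization.exists_smul_eq_mk_rep K v hv
  have : F.eval (Projectivization.mk K v hv).rep = (a : K) ^ 2 * F.eval v := by
    rw [← ha]
    simp only [Conic.eval, Pi.smul_apply, Units.smul_def, smul_eq_mul]
    ring
  change F.eval _ = 0 ↔ _
  rw [this]
  simp

theorem mk_mem_line (u v : Fin 3 → K) (hv : v ≠ 0) :
    Projectivization.mk K v hv ∈ line u ↔ v 0 * u 0 + v 1 * u 1 + v 2 * u 2 = 0 := by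
  obtain ⟨a, ha⟩ := Projectivization.exists_smul_eq_mk_rep K v hv
  have : ∑ i, (Projectivization.mk K v hv).rep i * u i =
      (a : K) * (v 0 * u 0 + v 1 * u 1 + v 2 * u 2) := by
    rw [← ha]
    simp only [Fin.sum_univ_three, Pi.smul_apply, Units.smul_def, smul_eq_mul]
    ring
  change ∑ i, _ = 0 ↔ _
  rw [this]
  simp

theorem vec_ne_zero {v : Fin 3 → K} (i : Fin 3) (hi : v i ≠ 0) : v ≠ 0 :=
  fun h => hi (by simp [h])

theorem nucleus_notMem_points {F : Conic K} (hF : F.lam ≠ 0) : nucleus K ∉ F.points := by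
  rw [nucleus, mk_mem_points]
  simpa [Conic.eval] using hF

theorem mk_eq_nucleus {v : Fin 3 → K} (hv : v ≠ 0) (h0 : v 0 = 0) (h1 : v 1 = 0) :
    Projectivization.mk K v hv = nucleus K := by
  rw [nucleus, Projectivization.mk_eq_mk_iff']
  exact ⟨v 2, by ext i; fin_cases i <;> simp [h0, h1]⟩

theorem mem_arc {C : Set (Conic K)} {p : Point K} :
    p ∈ arc C ↔ (∃ F ∈ C, p ∈ F.points) ∨ p = nucleus K := by
  simp [arc, conics, or_comm]

theorem isCollineationWith_iff {σ : RingAut K} {g : Equiv.Perm (Point K)} :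
    IsCollineationWith σ g ↔ ∃ f : (Fin 3 → K) →ₛₗ[(σ : K →+* K)] (Fin 3 → K),
      ∃ hf : ∀ v, v ≠ 0 → f v ≠ 0, ∀ v hv,
        g (Projectivization.mk K v hv) = Projectivization.mk K (f v) (hf v hv) := by
  constructor
  · rintro ⟨f, hf, hg⟩
    exact ⟨f, fun v hv h => hv (hf (by rw [h, map_zero])), fun v hv => hg _⟩
  · rintro ⟨f, hf, hg⟩
    refine ⟨f, (injective_iff_map_eq_zero f).2 fun v hv => by_contra fun h => hf v h hv, fun p => ?_⟩
    induction p using Projectivization.ind with | h v hv => exact hg v hv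

theorem IsCollineationWith.one : IsCollineationWith (1 : RingAut K) 1 :=
  isCollineationWith_iff.2 ⟨LinearMap.id (R := K) (M := Fin 3 → K), fun _ h => h, fun _ _ => rfl⟩

theorem IsCollineationWith.mul {σ τ : RingAut K} {g g' : Equiv.Perm (Point K)}
    (hg : IsCollineationWith σ g) (hg' : IsCollineationWith τ g') :
    IsCollineationWith (σ * τ) (g * g') := by
  obtain ⟨f, hf, h⟩ := isCollineationWith_iff.1 hg
  obtain ⟨f', hf', h'⟩ := isCollineationWith_iff.1 hg'
  refine isCollineationWith_iff.2 ⟨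
    { toFun := fun v => f (f' v), map_add' := fun v w => by simp, map_smul' := fun c v => by
        simp [map_smulₛₗ] }, fun v hv => hf _ (hf' _ hv), fun v hv => ?_⟩
  rw [Equiv.Perm.mul_apply, h', h]
  rfl

instance ringHomInvPair_inv (σ : RingAut K) :
    RingHomInvPair (σ : K →+* K) ((σ⁻¹ : RingAut K) : K →+* K) where
  comp_eq := RingHom.ext fun x => σ.symm_apply_apply x
  comp_eq₂ := RingHom.ext fun x => σ.apply_symm_apply x

instance ringHomInvPair_inv' (σ : RingAut K) :
    RingHomInvPair ((σ⁻¹ : RingAut K) : K →+* K) (σ : K →+* K) where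
  comp_eq := RingHom.ext fun x => σ.apply_symm_apply x
  comp_eq₂ := RingHom.ext fun x => σ.symm_apply_apply x

theorem IsCollineationWith.inv {σ : RingAut K} {g : Equiv.Perm (Point K)}
    (hg : IsCollineationWith σ g) : IsCollineationWith σ⁻¹ g⁻¹ := by
  obtain ⟨f, hf, h⟩ := hg
  -- Undoing σ on the coordinates first makes f linear, so injectivity gives surjectivity by
  -- dimension.
  let f' : (Fin 3 → K) →ₗ[K] (Fin 3 → K) :=
    { toFun := fun v => f (fun i => σ⁻¹ (v i))
      map_add' := fun v w => by
        rw [← map_add]; congr 1; ext i; simp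
      map_smul' := fun c v => by
        have : (fun i => σ⁻¹ ((c • v) i)) = (σ⁻¹ c) • fun i => σ⁻¹ (v i) := by ext i; simp
        rw [this, map_smulₛₗ]; simp }
  have hinj : Function.Injective f' := fun v w hvw => by
    ext i
    exact σ⁻¹.injective (congrFun (hf hvw) i)
  have hsurj : Function.Surjective f := fun w => by
    obtain ⟨v, hv⟩ := LinearMap.surjective_of_injective hinj w
    exact ⟨_, hv⟩
  let e := LinearEquiv.ofBijective (σ₂₁ := ((σ⁻¹ : RingAut K) : K →+* K)) f ⟨hf, hsurj⟩
  refine isCollineationWith_iff.2 ⟨e.symm.toLinearMap, fun v hv => ?_, fun v hv => ?_⟩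
  · simpa using hv
  · rw [Equiv.Perm.inv_eq_iff_eq, h, Projectivization.map_mk]
    congr 1
    exact (e.apply_symm_apply v).symm

theorem IsCollineationWith.pow {σ : RingAut K} {g : Equiv.Perm (Point K)}
    (hg : IsCollineationWith σ g) (n : ℕ) : IsCollineationWith (σ ^ n) (g ^ n) := by
  induction n with
  | zero => simpa using IsCollineationWith.one
  | succ n ih => rw [pow_succ, pow_succ]; exact ih.mul hg

theorem IsCollineation.mul {g g' : Equiv.Perm (Point K)}
    (hg : IsCollineation g) (hg' : IsCollineation g') : IsCollineation (g * g') :=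
  ⟨_, hg.choose_spec.mul hg'.choose_spec⟩

theorem IsCollineation.inv {g : Equiv.Perm (Point K)} (hg : IsCollineation g) :
    IsCollineation g⁻¹ :=
  ⟨_, hg.choose_spec.inv⟩

theorem Isomorphic.trans {S T U : Set (Point K)} (h : Isomorphic S T) (h' : Isomorphic T U) :
    Isomorphic S U := by
  obtain ⟨g, hg, rfl⟩ := h
  obtain ⟨g', hg', rfl⟩ := h'
  exact ⟨g' * g, hg'.mul hg, by rw [Equiv.Perm.coe_mul, Set.image_comp]⟩

theorem Isomorphic.symm {S T : Set (Point K)} (h : Isomorphic S T) : Isomorphic T S := by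
  obtain ⟨g, hg, rfl⟩ := h
  exact ⟨g⁻¹, hg.inv, by rw [← Set.image_comp, ← Equiv.Perm.coe_mul]; simp⟩

/-- A semilinear map inducing the identity sends (1, t, 0) to a multiple of itself, and comparing
coordinates gives σ t = t. Thus g^n = 1 forces σ^n = 1 for the companion σ of g. -/
theorem IsCollineationWith.eq_one {σ : RingAut K} (h : IsCollineationWith σ 1) : σ = 1 := by
  obtain ⟨f, hf, h⟩ := isCollineationWith_iff.1 h
  have key : ∀ v, v ≠ 0 → ∃ c : K, c • v = f v := fun v hv => by
    have := h v hv
    rwa [Equiv.Perm.one_apply, eq_comm, Projectivization.mk_eq_mk_iff'] at this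
  have hne : ∀ t : K, (![1, t, 0] : Fin 3 → K) ≠ 0 := fun t => vec_ne_zero 0 (by simp)
  obtain ⟨c, hc⟩ := key ![1, 0, 0] (hne 0)
  obtain ⟨d, hd⟩ := key ![0, 1, 0] (vec_ne_zero 1 (by simp))
  have hf1 := hf ![1, 0, 0] (hne 0)
  have hadd : ∀ t : K, f ![1, t, 0] = ![c, σ t * d, 0] := fun t => by
    have : (![1, t, 0] : Fin 3 → K) = ![1, 0, 0] + t • ![0, 1, 0] := by simp
    rw [this, map_add, map_smulₛₗ, ← hc, ← hd]
    simp
  have hc0 : c ≠ 0 := by rintro rfl; simp [← hc] at hf1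
  have hmul : ∀ t : K, c * t = σ t * d := fun t => by
    obtain ⟨e, he⟩ := key _ (hne t)
    rw [hadd] at he
    have h0 := congrFun he 0
    have h1 := congrFun he 1
    simp at h0 h1
    rw [← h0, h1]
  have hcd : c = d := by simpa using hmul 1
  ext t
  have := hmul t
  rw [← hcd, mul_comm] at this
  exact (mul_right_cancel₀ hc0 this).symm

theorem image_points {σ : RingAut K} {g : Equiv.Perm (Point K)}
    {f : (Fin 3 → K) →ₛₗ[(σ : K →+* K)] (Fin 3 → K)} {hf : ∀ v, v ≠ 0 → f v ≠ 0}
    (hg : ∀ v hv, g (Projectivization.mk K v hv) = Projectivization.mk K (f v) (hf v hv))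
    {F F' : Conic K} (h : ∀ v, F'.eval (f v) = 0 ↔ F.eval v = 0) :
    g '' F.points = F'.points := by
  have key : ∀ p, g p ∈ F'.points ↔ p ∈ F.points := fun p => by
    induction p using Projectivization.ind with | h v hv =>
    rw [hg, mk_mem_points, mk_mem_points, h]
  ext p
  rw [Equiv.image_eq_preimage_symm, Set.mem_preimage, ← key, Equiv.apply_symm_apply]

theorem image_arc {g : Equiv.Perm (Point K)} {C C' : Set (Conic K)} (hN : g (nucleus K) = nucleus K)
    (h : (fun X : Set (Point K) => g '' X) '' conics C = conics C') : g '' arc C = arc C' := by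
  rw [arc, arc, Set.image_union, Set.image_singleton, hN, ← h, Set.sUnion_image,
    Set.image_sUnion, Set.sUnion_image]

/-- The semilinear map `(x, y, z) ↦ (x ^ σ, y ^ σ + r x ^ σ, c z ^ σ + u x ^ σ)`. -/
def shearMap (σ : RingAut K) (r c u : K) : (Fin 3 → K) →ₛₗ[(σ : K →+* K)] (Fin 3 → K) where
  toFun v := ![σ (v 0), σ (v 1) + r * σ (v 0), c * σ (v 2) + u * σ (v 0)]
  map_add' v w := by
    ext i; fin_cases i <;> simp <;> ring
  map_smul' t v := by
    ext i; fin_cases i <;> simp <;> ring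

theorem shearMap_ne_zero (σ : RingAut K) (r u : K) {c : K} (hc : c ≠ 0) (v : Fin 3 → K)
    (hv : v ≠ 0) : shearMap σ r c u v ≠ 0 := by
  contrapose! hv
  have h0 : v 0 = 0 := by simpa [shearMap] using congrFun hv 0
  have h1 : v 1 = 0 := by simpa [shearMap, h0] using congrFun hv 1
  have h2 : v 2 = 0 := by simpa [shearMap, h0, hc] using congrFun hv 2
  ext i; fin_cases i <;> simp [h0, h1, h2]

theorem exists_perm_mk_eq [Finite K] {σ : RingAut K}
    (f : (Fin 3 → K) →ₛₗ[(σ : K →+* K)] (Fin 3 → K)) (hf : ∀ v, v ≠ 0 → f v ≠ 0) :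
    ∃ g : Equiv.Perm (Point K), ∀ v hv,
      g (Projectivization.mk K v hv) = Projectivization.mk K (f v) (hf v hv) := by
  have hinj : Function.Injective f :=
    (injective_iff_map_eq_zero f).2 fun v hv => by_contra fun h => hf v h hv
  have : Finite (Point K) := Quotient.finite _
  have hb : Function.Bijective (Projectivization.map f hinj) :=
    Finite.injective_iff_bijective.1
      (Projectivization.map_injective (τ := ((σ⁻¹ : RingAut K) : K →+* K)) f hinj)
  exact ⟨Equiv.ofBijective _ hb, fun v hv => rfl⟩

end Collineations

/-! ### The standard arc: closedness and disjointness of its conics -/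

section StandardForm

variable {K : Type*} [Field K]

/-- The conic `(1 + X ^ 3) x² + x y + y² + X z² = 0`. -/
def stdConic (X : K) : Conic K := ⟨1 + X ^ 3, 1, X⟩

/-- The conics `stdConic X`, where `X` runs over the roots of `1 + X ^ k + X ^ 7`. -/
def stdConics (K : Type*) [Field K] (k : ℕ) : Set (Conic K) := stdConic '' singerRoots K k

theorem stdConic_injective : Function.Injective (stdConic : K → Conic K) :=
  fun _ _ h => congrArg Conic.lam h

theorem exists_sq_eq [Finite K] [CharP K 2] (t : K) : ∃ y, y ^ 2 = t := by
  have : ExpChar K 2 := ExpChar.prime Nat.prime_two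
  exact surjective_frobenius K 2 t

variable [Finite K] [Algebra (ZMod 2) K] {k h : ℕ}

theorem isMathon_stdConic (hcard : Nat.card K = 2 ^ h) (hodd : Odd h) (hk : k = 1 ∨ k = 3) {X : K}
    (hX : X ∈ singerRoots K k) : (stdConic X).IsMathon := by
  have := charP_two K
  refine ⟨?_, ne_zero_of_mem hk hX⟩
  simp [stdConic, trace_one hcard hodd, trace_pow_three hk hX]

theorem isClosedSet_stdConics (hcard : Nat.card K = 2 ^ h) (hodd : Odd h) (hk : k = 1 ∨ k = 3) :
    IsClosedSet (stdConics K k) := by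
  have := charP_two K
  constructor
  · rintro _ ⟨X, hX, rfl⟩
    exact isMathon_stdConic hcard hodd hk hX
  · rintro _ ⟨X, hX, rfl⟩ _ ⟨Y, hY, rfl⟩ hne
    have hXY : X ≠ Y := fun h => hne (by rw [h])
    have hs := add_mem_singerRoots hk hX hY hXY
    have h0 := ne_zero_of_mem hk hs
    refine ⟨hXY, X + Y, hs, ?_⟩
    ext
    · simp only [stdConic, Conic.comp]
      rw [eq_div_iff h0]
      -- Here α times `lam` is X + X^4, which is additive in X.
      grind
    · simp only [stdConic, Conic.comp, one_mul]
      rw [div_self h0]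
    · rfl

/-- A common point of the conics of X and Y also lies on that of X + Y. If x ≠ 0, dividing by x^2
gives Tr(Z (z/x)^2) = 1 for Z = X, Y and X + Y, against additivity of the trace. -/
theorem stdConic_disjoint (hcard : Nat.card K = 2 ^ h) (hodd : Odd h) (hk : k = 1 ∨ k = 3)
    {X Y : K} (hX : X ∈ singerRoots K k) (hY : Y ∈ singerRoots K k) {p : Point K}
    (hpX : p ∈ (stdConic X).points) (hpY : p ∈ (stdConic Y).points) : X = Y := by
  have := charP_two K
  by_contra hne
  induction p using Projectivization.ind with | h v hv =>
  rw [mk_mem_points] at hpX hpY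
  have hs := add_mem_singerRoots hk hX hY hne
  have htr : ∀ Z ∈ singerRoots K k, (stdConic Z).eval v = 0 → v 0 ≠ 0 →
      Algebra.trace (ZMod 2) K (Z * (v 2 / v 0) ^ 2) = 1 := by
    intro Z hZ hpZ h0
    have : Z * (v 2 / v 0) ^ 2 = 1 + Z ^ 3 + ((v 1 / v 0) ^ 2 + v 1 / v 0) := by
      simp only [Conic.eval, stdConic] at hpZ
      field_simp
      grind
    rw [this, map_add, trace_sq_add_self, map_add, trace_one hcard hodd, trace_pow_three hk hZ]
    simp
  by_cases h0 : v 0 = 0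
  · simp only [Conic.eval, stdConic, h0] at hpX hpY
    have h2 : (X + Y) * v 2 ^ 2 = 0 := by grind
    have h2' : v 2 = 0 := by simpa [ne_zero_of_mem hk hs] using h2
    have h1 : v 1 = 0 := by simpa [h2'] using hpX
    exact hv (by ext i; fin_cases i <;> simp [h0, h1, h2'])
  · have hpS : (stdConic (X + Y)).eval v = 0 := by
      refine (mul_eq_zero.1 ?_).resolve_left (ne_zero_of_mem hk hs)
      simp only [Conic.eval, stdConic] at hpX hpY ⊢
      grind
    have h1 := htr _ hs hpS h0
    rw [add_mul, map_add, htr _ hX hpX h0, htr _ hY hpY h0] at h1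
    exact absurd h1 (by decide)

theorem exists_mem_stdConic (X : K) : ∃ p, p ∈ (stdConic X).points := by
  have := charP_two K
  obtain ⟨y, hy⟩ := exists_sq_eq X
  refine ⟨Projectivization.mk K ![0, y, 1] (vec_ne_zero 2 (by simp)), ?_⟩
  rw [mk_mem_points]
  simp [Conic.eval, stdConic, hy, CharTwo.add_self_eq_zero]

theorem points_injOn_stdConics (hcard : Nat.card K = 2 ^ h) (hodd : Odd h)
    (hk : k = 1 ∨ k = 3) : Set.InjOn Conic.points (stdConics K k) := by
  rintro _ ⟨X, hX, rfl⟩ _ ⟨Y, hY, rfl⟩ hXY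
  obtain ⟨p, hp⟩ := exists_mem_stdConic X
  rw [stdConic_disjoint hcard hodd hk hX hY hp (hXY ▸ hp)]

theorem ncard_stdConics (hk : k = 1 ∨ k = 3) {a : K} (ha : a ∈ singerRoots K k) :
    (stdConics K k).ncard = 7 := by
  have := charP_two K
  rw [stdConics, Set.ncard_image_of_injective _ stdConic_injective, singerRoots_ncard hk ha]

end StandardForm

/-! ### Intersections of the standard arc with lines -/

section MaximalArc

variable {K : Type*} [Field K] [Finite K] [Algebra (ZMod 2) K] {k h : ℕ}

/-- If L takes the value 1 at a root Y, translation by Y exchanges the halves L = 0 and L = 1 of the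
group of order 8, so each has four elements; 0 lies in the other half. -/
theorem ncard_filter_eq_one (hk : k = 1 ∨ k = 3) {a : K} (ha : a ∈ singerRoots K k)
    (L : K →+ ZMod 2) :
    {X ∈ singerRoots K k | L X = 1}.ncard = 0 ∨ {X ∈ singerRoots K k | L X = 1}.ncard = 4 := by
  have := charP_two K
  rcases Set.eq_empty_or_nonempty {X ∈ singerRoots K k | L X = 1} with he | ⟨Y, hY, hLY⟩
  · left; rw [he, Set.ncard_empty]
  right
  have hYY : Y + Y = 0 := CharTwo.add_self_eq_zero Y
  have hYX : ∀ X, X + Y + Y = X := fun X => by rw [add_assoc, hYY, add_zero]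
  have hV : ∀ X ∈ insert 0 (singerRoots K k), X + Y ∈ insert 0 (singerRoots K k) := by
    rintro X (rfl | hX)
    · right; simpa using hY
    · by_cases hXY : X = Y
      · left; rw [hXY, hYY]
      · right; exact add_mem_singerRoots hk hX hY hXY
  have h2 : ∀ t : ZMod 2, t = 0 ∨ t = 1 := by decide
  have himg : (fun X => X + Y) '' {X ∈ singerRoots K k | L X = 1} =
      {X ∈ insert 0 (singerRoots K k) | L X = 0} := by
    ext X
    constructor
    · rintro ⟨Z, ⟨hZ, hLZ⟩, rfl⟩
      exact ⟨hV Z (Or.inr hZ), by simp only [map_add, hLZ, hLY]; decide⟩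
    · rintro ⟨hX, hLX⟩
      refine ⟨X + Y, ⟨(hV X hX).resolve_left fun h => ?_, ?_⟩, hYX X⟩
      · have := congrArg L h
        rw [map_add, hLX, hLY, map_zero] at this
        exact absurd this (by decide)
      · rw [map_add, hLX, hLY, zero_add]
  have hun : {X ∈ insert 0 (singerRoots K k) | L X = 0} ∪ {X ∈ singerRoots K k | L X = 1} =
      insert 0 (singerRoots K k) := by
    ext X
    constructor
    · rintro (hX | hX)
      · exact hX.1
      · exact Or.inr hX.1
    · intro hX
      rcases h2 (L X) with h | h
      · exact Or.inl ⟨hX, h⟩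
      · exact Or.inr ⟨hX.resolve_left fun h0 => by simp [h0] at h, h⟩
  have hdis : Disjoint {X ∈ insert 0 (singerRoots K k) | L X = 0}
      {X ∈ singerRoots K k | L X = 1} := by
    rw [Set.disjoint_left]
    rintro X ⟨-, h0⟩ ⟨-, h1⟩
    rw [h0] at h1
    exact absurd h1 (by decide)
  have hc := Set.ncard_union_eq hdis (Set.toFinite _) (Set.toFinite _)
  rw [hun, Set.ncard_insert_of_notMem (fun h0 => ne_zero_of_mem hk h0 rfl) (Set.toFinite _),
    singerRoots_ncard hk ha, ← himg,
    Set.ncard_image_of_injective _ (add_left_injective Y)] at hc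
  omega

/-- A line off the point `(0, 0, 1)` meets a conic in `0` or `2` points. -/
theorem ncard_points_inter_line {F : Conic K} {u : Fin 3 → K} (hu : u 2 ≠ 0)
    {A B : K} (hA : A = F.α + F.lam * (u 0 / u 2) ^ 2) (hB : B = F.β + F.lam * (u 1 / u 2) ^ 2) :
    (Algebra.trace (ZMod 2) K (A * B) ≠ 0 → (F.points ∩ line u).ncard = 0) ∧
    (Algebra.trace (ZMod 2) K (A * B) = 0 → (F.points ∩ line u).ncard = 2) := by
  have := charP_two K
  have hmem : ∀ v hv, Projectivization.mk K v hv ∈ F.points ∩ line u ↔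
      A * v 0 ^ 2 + v 0 * v 1 + B * v 1 ^ 2 = 0 ∧ v 2 = u 0 / u 2 * v 0 + u 1 / u 2 * v 1 := by
    intro v hv
    rw [Set.mem_inter_iff, mk_mem_points, mk_mem_line, and_comm]
    have : v 0 * u 0 + v 1 * u 1 + v 2 * u 2 = 0 ↔ v 2 = u 0 / u 2 * v 0 + u 1 / u 2 * v 1 := by
      field_simp
      constructor <;> intro h' <;> grind
    rw [this, and_comm]
    refine and_congr_left fun h' => ?_
    have : F.eval v = A * v 0 ^ 2 + v 0 * v 1 + B * v 1 ^ 2 := by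
      rw [Conic.eval, h', hA, hB, CharTwo.add_sq]
      ring
    rw [this]
  have hpt : ∀ x y : K, (x ≠ 0 ∨ y ≠ 0) → (![x, y, u 0 / u 2 * x + u 1 / u 2 * y] : Fin 3 → K) ≠ 0 :=
    fun x y h' => h'.elim (fun h' => vec_ne_zero 0 h') fun h' => vec_ne_zero 1 h'
  have heq : ∀ v hv x y h', (∃ c : K, v 0 = c * x ∧ v 1 = c * y) →
      v 2 = u 0 / u 2 * v 0 + u 1 / u 2 * v 1 →
      Projectivization.mk K v hv = Projectivization.mk K _ (hpt x y h') := by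
    rintro v hv x y h' ⟨c, h0, h1⟩ h2
    rw [Projectivization.mk_eq_mk_iff']
    refine ⟨c, ?_⟩
    ext i
    fin_cases i <;> simp [h0, h1, h2]
    ring
  constructor
  · intro htr
    rw [Set.ncard_eq_zero (Set.toFinite _), Set.eq_empty_iff_forall_notMem]
    intro p
    induction p using Projectivization.ind with | h v hv =>
    rw [hmem]
    rintro ⟨h1, h2⟩
    refine htr ?_
    by_cases hy : v 1 = 0
    · have hx : v 0 ≠ 0 := fun hx => hv (by ext i; fin_cases i <;> simp [hx, hy, h2])
      have : A = 0 := by simpa [hy, hx] using h1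
      simp [this]
    · have : A * B = (A * v 0 / v 1) ^ 2 + A * v 0 / v 1 := by
        field_simp
        grind
      rw [this, trace_sq_add_self]
  · intro htr
    -- This w splits the restricted form: B(A x^2 + xy + B y^2) = (B y + w x)(B y + (w + 1) x). For
    -- B = 0 the form is x(A x + y) instead.
    obtain ⟨w, hw⟩ := exists_sq_add_self_eq htr
    rw [Set.ncard_eq_two]
    by_cases hB0 : B = 0
    · refine ⟨Projectivization.mk K _ (hpt 0 1 (by simp)),
        Projectivization.mk K _ (hpt 1 A (by simp)), ?_, ?_⟩
      · rw [Ne, Projectivization.mk_eq_mk_iff']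
        rintro ⟨c, hc⟩
        have h0 := congrFun hc 0
        have h1 := congrFun hc 1
        simp at h0 h1
        simp [h0] at h1
      · ext p
        induction p using Projectivization.ind with | h v hv =>
        rw [hmem, Set.mem_insert_iff, Set.mem_singleton_iff]
        constructor
        · rintro ⟨h1, h2⟩
          have : v 0 * (A * v 0 + v 1) = 0 := by rw [hB0] at h1; linear_combination h1
          rcases mul_eq_zero.1 this with h0 | h0
          · exact Or.inl (heq v hv 0 1 (by simp) ⟨v 1, by simp [h0], by simp⟩ h2)
          · exact Or.inr (heq v hv 1 A (by simp) ⟨v 0, by simp, by grind⟩ h2)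
        · rintro (h' | h') <;> rw [← hmem v hv, h', hmem]
          · simp [hB0]
          · simp [hB0, CharTwo.add_self_eq_zero]
    · refine ⟨Projectivization.mk K _ (hpt B w (by simp [hB0])),
        Projectivization.mk K _ (hpt B (w + 1) (by simp [hB0])), ?_, ?_⟩
      · rw [Ne, Projectivization.mk_eq_mk_iff']
        rintro ⟨c, hc⟩
        have h0 := congrFun hc 0
        have h1 := congrFun hc 1
        simp [hB0] at h0 h1
        simp [h0] at h1
      · ext p
        induction p using Projectivization.ind with | h v hv =>
        rw [hmem, Set.mem_insert_iff, Set.mem_singleton_iff]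
        constructor
        · rintro ⟨h1, h2⟩
          have : (B * v 1 + w * v 0) * (B * v 1 + (w + 1) * v 0) = 0 := by grind
          rcases mul_eq_zero.1 this with h0 | h0
          · refine Or.inl (heq v hv B w (by simp [hB0]) ⟨v 0 / B, ?_, ?_⟩ h2) <;> field_simp
            grind
          · refine Or.inr (heq v hv B (w + 1) (by simp [hB0]) ⟨v 0 / B, ?_, ?_⟩ h2) <;> field_simp
            grind
        · rintro (h' | h') <;> rw [← hmem v hv, h', hmem] <;> simp <;> grind

/-- A line through the point `(0, 0, 1)` meets the standard arc in eight points. -/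
theorem ncard_arc_inter_line_of_eq_zero (hcard : Nat.card K = 2 ^ h) (hodd : Odd h)
    (hk : k = 1 ∨ k = 3) {a : K} (ha : a ∈ singerRoots K k) {u : Fin 3 → K} (hu : u ≠ 0)
    (hu2 : u 2 = 0) : (arc (stdConics K k) ∩ line u).ncard = 8 := by
  have := charP_two K
  -- Apart from (0,0,1), the line consists of the points (u 1, u 0, z). Square roots being unique,
  -- each conic contains exactly one of them, and 7 + 1 = 8.
  choose z hz using fun X : K =>
    exists_sq_eq (((1 + X ^ 3) * u 1 ^ 2 + u 1 * u 0 + u 0 ^ 2) / X)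
  have hne : ∀ X, (![u 1, u 0, z X] : Fin 3 → K) ≠ 0 := fun X h' => hu (by
    have h0 : u 1 = 0 := congrFun h' 0
    have h1 : u 0 = 0 := congrFun h' 1
    ext i; fin_cases i <;> simp [h0, h1, hu2])
  let P : K → Point K := fun X => Projectivization.mk K _ (hne X)
  have hP : ∀ X ∈ singerRoots K k, P X ∈ (stdConic X).points := fun X hX => by
    have h0 := ne_zero_of_mem hk hX
    have := hz X
    rw [eq_div_iff h0] at this
    rw [mk_mem_points]
    simp [Conic.eval, stdConic]
    grind
  have hset : arc (stdConics K k) ∩ line u = insert (nucleus K) (P '' singerRoots K k) := by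
    ext p
    rw [Set.mem_inter_iff, mem_arc, Set.mem_insert_iff]
    constructor
    · rintro ⟨⟨_, ⟨X, hX, rfl⟩, hp⟩ | rfl, hl⟩
      · right
        refine ⟨X, hX, ?_⟩
        induction p using Projectivization.ind with | h v hv =>
        rw [mk_mem_points] at hp
        rw [mk_mem_line, hu2] at hl
        obtain ⟨s, h0, h1⟩ : ∃ s, v 0 = s * u 1 ∧ v 1 = s * u 0 := by
          by_cases hu0 : u 0 = 0
          · have hu1 : u 1 ≠ 0 := fun hu1 =>
              hu (by ext i; fin_cases i <;> simp [hu0, hu1, hu2])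
            exact ⟨v 0 / u 1, by field_simp, by simpa [hu0, hu1] using hl⟩
          · exact ⟨v 1 / u 0, by field_simp; grind, by field_simp⟩
        have hX0 := ne_zero_of_mem hk hX
        have hs : s ≠ 0 := by
          rintro rfl
          simp only [zero_mul] at h0 h1
          have h2 : v 2 = 0 := by simpa [Conic.eval, stdConic, h0, h1, hX0] using hp
          exact hv (by ext i; fin_cases i <;> simp [h0, h1, h2])
        have h2 : v 2 = s * z X := by
          have := hz X
          rw [eq_div_iff hX0] at this
          simp only [Conic.eval, stdConic, h0, h1] at hp
          have h3 : X * (v 2 + s * z X) ^ 2 = 0 := by grind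
          have h4 : v 2 + s * z X = 0 := by simpa [hX0] using h3
          grind
        rw [eq_comm, Projectivization.mk_eq_mk_iff']
        exact ⟨s, by ext i; fin_cases i <;> simp [h0, h1, h2]⟩
      · exact Or.inl rfl
    · rintro (rfl | ⟨X, hX, rfl⟩)
      · refine ⟨Or.inr rfl, ?_⟩
        rw [nucleus, mk_mem_line]
        simp [hu2]
      · refine ⟨Or.inl ⟨_, ⟨X, hX, rfl⟩, hP X hX⟩, ?_⟩
        rw [mk_mem_line]
        simp [hu2, mul_comm, CharTwo.add_self_eq_zero]
  have hinj : Set.InjOn P (singerRoots K k) := fun X hX Y hY hXY =>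
    stdConic_disjoint hcard hodd hk hX hY (hP X hX) (hXY ▸ hP Y hY)
  rw [hset, Set.ncard_insert_of_notMem ?_ (Set.toFinite _), hinj.ncard_image,
    singerRoots_ncard hk ha]
  rintro ⟨X, hX, hXN⟩
  exact nucleus_notMem_points (F := stdConic X) (ne_zero_of_mem hk hX) (hXN ▸ hP X hX)

/-- A line off the point `(0, 0, 1)` meets the standard arc in zero or eight points. -/
theorem ncard_arc_inter_line_of_ne_zero (hcard : Nat.card K = 2 ^ h) (hodd : Odd h)
    (hk : k = 1 ∨ k = 3) {a : K} (ha : a ∈ singerRoots K k) {u : Fin 3 → K} (hu2 : u 2 ≠ 0) :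
    (arc (stdConics K k) ∩ line u).ncard = 0 ∨ (arc (stdConics K k) ∩ line u).ncard = 8 := by
  classical
  have := charP_two K
  set s := u 0 / u 2 with hs
  set t := u 1 / u 2 with ht
  let T := (Algebra.trace (ZMod 2) K).toAddMonoidHom
  -- The trace deciding the intersection with the conic of X contains Tr(X^2 s^2 t^2), which equals
  -- Tr(X s t). After this replacement everything except Tr(1 + X^3) = 1 is additive in X.
  let L : K →+ ZMod 2 := T.comp ((AddMonoidHom.mulRight (s ^ 2 + t ^ 2 + s * t)) +
    ((AddMonoidHom.mulRight (t ^ 2)).comp (iterateFrobenius K 2 2).toAddMonoidHom))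
  have hL : ∀ X, L X = Algebra.trace (ZMod 2) K
      (X * (s ^ 2 + t ^ 2 + s * t) + X ^ 4 * t ^ 2) := fun X => by
    simp [L, T, iterateFrobenius_def]
  have htr : ∀ X ∈ singerRoots K k, Algebra.trace (ZMod 2) K
      ((1 + X ^ 3 + X * s ^ 2) * (1 + X * t ^ 2)) = 1 + L X := fun X hX => by
    have : (1 + X ^ 3 + X * s ^ 2) * (1 + X * t ^ 2) = 1 + X ^ 3 +
        (X * (s ^ 2 + t ^ 2 + s * t) + X ^ 4 * t ^ 2) + ((X * s * t) ^ 2 + X * s * t) := by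
      grind
    rw [this, map_add, trace_sq_add_self, map_add _ (1 + X ^ 3), ← hL, map_add,
      trace_one hcard hodd, trace_pow_three hk hX, add_zero, add_zero]
  have hcount : ∀ X ∈ singerRoots K k, ((stdConic X).points ∩ line u).ncard =
      if L X = 1 then 2 else 0 := fun X hX => by
    obtain ⟨h1, h2⟩ := ncard_points_inter_line (F := stdConic X) hu2 (A := 1 + X ^ 3 + X * s ^ 2)
      (B := 1 + X * t ^ 2) rfl rfl
    rw [htr X hX] at h1 h2
    split_ifs with hLX
    · exact h2 (by rw [hLX]; rfl)
    · refine h1 fun h' => hLX ?_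
      have : ∀ c : ZMod 2, 1 + c = 0 → c = 1 := by decide
      exact this _ h'
  let R := (Set.toFinite (singerRoots K k)).toFinset
  let D : K → Finset (Point K) := fun X => (Set.toFinite ((stdConic X).points ∩ line u)).toFinset
  have hset : arc (stdConics K k) ∩ line u = (R.biUnion D : Set (Point K)) := by
    ext p
    rw [Set.mem_inter_iff, mem_arc]
    simp only [Finset.coe_biUnion, Set.Finite.coe_toFinset, Set.mem_iUnion, R, D]
    constructor
    · rintro ⟨⟨_, ⟨X, hX, rfl⟩, hp⟩ | rfl, hl⟩
      · exact ⟨X, hX, hp, hl⟩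
      · rw [nucleus, mk_mem_line] at hl
        simp [hu2] at hl
    · rintro ⟨X, hX, hp, hl⟩
      exact ⟨Or.inl ⟨_, ⟨X, hX, rfl⟩, hp⟩, hl⟩
  have hR : ∀ X, X ∈ R ↔ X ∈ singerRoots K k := fun X => Set.Finite.mem_toFinset _
  have hsum : (arc (stdConics K k) ∩ line u).ncard =
      2 * {X ∈ singerRoots K k | L X = 1}.ncard := by
    rw [hset, Set.ncard_coe_finset, Finset.card_biUnion]
    · have h1 : ∀ X ∈ R, (D X).card = if L X = 1 then 2 else 0 := fun X hX => by
        rw [← hcount X ((hR X).1 hX), Set.ncard_eq_toFinset_card _ (Set.toFinite _)]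
      have h2 : {X ∈ singerRoots K k | L X = 1} = ((R.filter fun X => L X = 1 : Finset K) : Set K) := by
        ext X; simp [hR]
      rw [Finset.sum_congr rfl h1, ← Finset.sum_filter, h2, Set.ncard_coe_finset]
      simp [mul_comm]
    · intro X hX Y hY hXY
      change Disjoint (D X) (D Y)
      rw [Finset.disjoint_left]
      intro p hpX hpY
      rw [Set.Finite.mem_toFinset] at hpX hpY
      exact hXY (stdConic_disjoint hcard hodd hk ((hR X).1 hX) ((hR Y).1 hY) hpX.1 hpY.1)
  rcases ncard_filter_eq_one hk ha L with h' | h' <;> rw [hsum, h'] <;> simp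

theorem isMaximalArc_stdConics (hcard : Nat.card K = 2 ^ h) (hodd : Odd h)
    (hk : k = 1 ∨ k = 3) {a : K} (ha : a ∈ singerRoots K k) :
    IsMaximalArc 8 (arc (stdConics K k)) := by
  have := charP_two K
  refine ⟨⟨nucleus K, mem_arc.2 (Or.inr rfl)⟩, fun huniv => ?_, fun u hu => ?_⟩
  · have h1 : Projectivization.mk K (![1, 0, 0] : Fin 3 → K) (vec_ne_zero 0 (by simp)) ∈
        arc (stdConics K k) := by rw [huniv]; trivial
    rcases mem_arc.1 h1 with ⟨_, ⟨X, hX, rfl⟩, hp⟩ | hp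
    · have h2 := (isMathon_stdConic hcard hodd hk hX).1
      rw [mk_mem_points] at hp
      simp [Conic.eval] at hp
      simp [hp] at h2
    · rw [nucleus, Projectivization.mk_eq_mk_iff'] at hp
      obtain ⟨c, hc⟩ := hp
      simpa using congrFun hc 0
  · by_cases hu2 : u 2 = 0
    · exact Or.inr (ncard_arc_inter_line_of_eq_zero hcard hodd hk ha hu hu2)
    · exact ncard_arc_inter_line_of_ne_zero hcard hodd hk ha hu2

end MaximalArc

/-! ### Collineations between arcs map conics to conics -/

section Rigidity

variable {K : Type*} [Field K]

open Polynomial in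
theorem quartic_eq_zero {c₀ c₁ c₂ c₃ c₄ : K} {S : Finset K} (hS : 4 < S.card)
    (hall : ∀ t ∈ S, c₀ + c₁ * t + c₂ * t ^ 2 + c₃ * t ^ 3 + c₄ * t ^ 4 = 0) :
    c₀ = 0 ∧ c₁ = 0 ∧ c₂ = 0 ∧ c₃ = 0 ∧ c₄ = 0 := by
  let P : K[X] := C c₀ + C c₁ * X + C c₂ * X ^ 2 + C c₃ * X ^ 3 + C c₄ * X ^ 4
  have hd : P.natDegree ≤ 4 := by simp only [P]; compute_degree
  have hP : P = 0 := eq_zero_of_natDegree_lt_card_of_eval_eq_zero' P S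
    (fun t ht => by simpa [P] using hall t ht) (hd.trans_lt hS)
  have hc : ∀ n, P.coeff n = 0 := fun n => by rw [hP, coeff_zero]
  refine ⟨?_, ?_, ?_, ?_, ?_⟩
  · simpa [P, coeff_X, coeff_C] using hc 0
  · simpa [P, coeff_X, coeff_C] using hc 1
  · simpa [P, coeff_X, coeff_C] using hc 2
  · simpa [P, coeff_X, coeff_C] using hc 3
  · simpa [P, coeff_X, coeff_C] using hc 4

/-- A quadratic form which vanishes in five points of a conic is a multiple of its equation. -/
theorem coeffs_eq_of_common_points [CharP K 2] {α β l A B C D E F : K} (hl : l ≠ 0)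
    {S : Finset K} (hS : 4 < S.card)
    (hall : ∀ t ∈ S, ∃ z, α + t + β * t ^ 2 + l * z ^ 2 = 0 ∧
      A + B * t ^ 2 + C * z ^ 2 + D * t + E * z + F * t * z = 0) :
    A = D * α ∧ B = D * β ∧ C = D * l ∧ E = 0 ∧ F = 0 := by
  -- Solving for (E + F t) z, squaring and eliminating z^2 leaves a quartic in t. In characteristic
  -- 2 its odd coefficients come only from E and F, so these vanish first.
  obtain ⟨h0, h1, h2, h3, h4⟩ := quartic_eq_zero (c₀ := (l * A + C * α) ^ 2 + l * E ^ 2 * α)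
    (c₁ := l * E ^ 2) (c₂ := (l * D + C) ^ 2 + l * E ^ 2 * β + l * F ^ 2 * α) (c₃ := l * F ^ 2)
    (c₄ := (l * B + C * β) ^ 2 + l * F ^ 2 * β) hS fun t ht => by
      obtain ⟨z, hz, hQ⟩ := hall t ht
      have hz' : l * z ^ 2 = α + t + β * t ^ 2 := by grind
      have hQ' : A + B * t ^ 2 + C * z ^ 2 + D * t = (E + F * t) * z := by grind
      have hQ2 : l ^ 2 * (A + B * t ^ 2 + C * z ^ 2 + D * t) ^ 2 =
          l * (E + F * t) ^ 2 * (α + t + β * t ^ 2) := by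
        rw [hQ', ← hz']; ring
      have hQ3 : l ^ 2 * (A + B * t ^ 2 + C * z ^ 2 + D * t) ^ 2 =
          (l * A + l * B * t ^ 2 + C * (α + t + β * t ^ 2) + l * D * t) ^ 2 := by
        rw [← hz']; ring
      rw [hQ3] at hQ2
      grind
  have hE : E = 0 := by simpa [hl] using h1
  have hF : F = 0 := by simpa [hl] using h3
  have h0' : l * A + C * α = 0 := by simpa [hE] using h0
  have h2' : l * D + C = 0 := by simpa [hE, hF] using h2
  have h4' : l * B + C * β = 0 := by simpa [hF] using h4
  have hC : C = D * l := by grind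
  refine ⟨mul_left_cancel₀ hl ?_, mul_left_cancel₀ hl ?_, hC, hE, hF⟩ <;> grind

theorem semilinear_apply {σ : RingAut K} (f : (Fin 3 → K) →ₛₗ[(σ : K →+* K)] (Fin 3 → K))
    (v : Fin 3 → K) (i : Fin 3) :
    f v i = f ![1, 0, 0] i * σ (v 0) + f ![0, 1, 0] i * σ (v 1) + f ![0, 0, 1] i * σ (v 2) := by
  have : v = v 0 • ![1, 0, 0] + v 1 • ![0, 1, 0] + v 2 • ![0, 0, 1] := by
    ext i; fin_cases i <;> simp
  conv_lhs => rw [this]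
  rw [map_add, map_add, map_smulₛₗ, map_smulₛₗ, map_smulₛₗ]
  simp [mul_comm]

theorem eval_semilinear (F : Conic K) {σ : RingAut K}
    (f : (Fin 3 → K) →ₛₗ[(σ : K →+* K)] (Fin 3 → K)) {p q m r s n u w c : K}
    (hp : f ![1, 0, 0] = ![p, r, u]) (hq : f ![0, 1, 0] = ![q, s, w])
    (hm : f ![0, 0, 1] = ![m, n, c]) (v : Fin 3 → K) [CharP K 2] :
    F.eval (f v) = (F.α * p ^ 2 + p * r + F.β * r ^ 2 + F.lam * u ^ 2) * σ (v 0) ^ 2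
      + (F.α * q ^ 2 + q * s + F.β * s ^ 2 + F.lam * w ^ 2) * σ (v 1) ^ 2
      + (F.α * m ^ 2 + m * n + F.β * n ^ 2 + F.lam * c ^ 2) * σ (v 2) ^ 2
      + (p * s + q * r) * (σ (v 0) * σ (v 1)) + (p * n + m * r) * (σ (v 0) * σ (v 2))
      + (q * n + m * s) * (σ (v 1) * σ (v 2)) := by
  rw [Conic.eval, semilinear_apply f v 0, semilinear_apply f v 1, semilinear_apply f v 2, hp, hq,
    hm]
  simp only [Matrix.cons_val]
  grind

/-- A collineation which maps a conic into an arc composed of few conics maps it onto one of them,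
and transforms its equation accordingly. -/
theorem exists_conic_eq_image [Finite K] [CharP K 2] (hcard : 128 ≤ Nat.card K) {σ : RingAut K}
    {g : Equiv.Perm (Point K)} (f : (Fin 3 → K) →ₛₗ[(σ : K →+* K)] (Fin 3 → K))
    (hf : ∀ v, v ≠ 0 → f v ≠ 0)
    (hg : ∀ v hv, g (Projectivization.mk K v hv) = Projectivization.mk K (f v) (hf v hv))
    {p q m r s n u w c : K} (hp : f ![1, 0, 0] = ![p, r, u]) (hq : f ![0, 1, 0] = ![q, s, w])
    (hm : f ![0, 0, 1] = ![m, n, c]) {F : Conic K} (hF : F.lam ≠ 0) {C : Set (Conic K)}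
    (hCfin : C.Finite) (hC : C.ncard ≤ 7) (hlam : ∀ F' ∈ C, F'.lam ≠ 0)
    (hsub : g '' F.points ⊆ arc C) :
    p * s + q * r ≠ 0 ∧ m = 0 ∧ n = 0 ∧ ∃ F' ∈ C, g '' F.points = F'.points ∧
      F'.lam * c ^ 2 = (p * s + q * r) * σ F.lam ∧
      F'.α * p ^ 2 + p * r + F'.β * r ^ 2 + F'.lam * u ^ 2 = (p * s + q * r) * σ F.α ∧
      F'.α * q ^ 2 + q * s + F'.β * s ^ 2 + F'.lam * w ^ 2 = (p * s + q * r) * σ F.β := by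
  classical
  have := Fintype.ofFinite K
  have hσl : σ F.lam ≠ 0 := by simpa using hF
  choose z hz using fun t : K =>
    exists_sq_eq ((σ F.α + t + σ F.β * t ^ 2) / σ F.lam)
  have hz' : ∀ t, σ F.α + t + σ F.β * t ^ 2 + σ F.lam * z t ^ 2 = 0 := fun t => by
    rw [hz]; field_simp; grind
  -- The inverse of σ is built in so that the coordinates become 1, t, z t after σ has acted, which
  -- makes the image condition polynomial in t.
  let V : K → Fin 3 → K := fun t => ![1, σ.symm t, σ.symm (z t)]
  have hV : ∀ t, V t ≠ 0 := fun t => vec_ne_zero 0 (by simp [V])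
  have hVF : ∀ t, F.eval (V t) = 0 := fun t => by
    apply σ.injective
    rw [map_zero, ← hz' t]
    simp [Conic.eval, V]
  let P : K → Point K := fun t => Projectivization.mk K (V t) (hV t)
  have hPinj : Function.Injective P := fun t t' h => by
    obtain ⟨e, he⟩ := (Projectivization.mk_eq_mk_iff' ..).1 h
    have h0 := congrFun he 0
    have h1 := congrFun he 1
    simp only [V, Pi.smul_apply, smul_eq_mul, Matrix.cons_val_zero, Matrix.cons_val_one,
      mul_one] at h0 h1
    rw [h0, one_mul] at h1
    exact (σ.symm.injective h1).symm
  have hP : ∀ t, g (P t) ∈ arc C := fun t =>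
    hsub ⟨P t, (mk_mem_points ..).2 (hVF t), rfl⟩
  let S : Conic K → Finset K := fun F' => Finset.univ.filter fun t => F'.eval (f (V t)) = 0
  let N : Finset K := Finset.univ.filter fun t => g (P t) = nucleus K
  have hN : N.card ≤ 1 := Finset.card_le_one.2 fun t ht t' ht' => hPinj (g.injective (by
    rw [(Finset.mem_filter.1 ht).2, (Finset.mem_filter.1 ht').2]))
  -- Pigeonhole: with at most four parameters on each of at most seven conics and one at the
  -- nucleus, only 29 of at least 128 would be covered.
  obtain ⟨F', hF', hS⟩ : ∃ F' ∈ C, 4 < (S F').card := by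
    by_contra! hcon
    have huniv : (Finset.univ : Finset K) ⊆ hCfin.toFinset.biUnion S ∪ N := fun t _ => by
      rw [Finset.mem_union, Finset.mem_biUnion]
      rcases mem_arc.1 (hP t) with ⟨F', hF', ht⟩ | ht
      · left
        refine ⟨F', by simpa, Finset.mem_filter.2 ⟨Finset.mem_univ _, ?_⟩⟩
        rwa [hg, mk_mem_points] at ht
      · exact Or.inr (Finset.mem_filter.2 ⟨Finset.mem_univ _, ht⟩)
    have h1 := Finset.card_le_card huniv
    have h2 := Finset.card_union_le (hCfin.toFinset.biUnion S) N
    have h3 := Finset.card_biUnion_le_card_mul hCfin.toFinset S 4 fun F' hF' =>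
      hcon F' (by simpa using hF')
    rw [← Set.ncard_eq_toFinset_card C hCfin] at h3
    rw [Finset.card_univ, Fintype.card_eq_nat_card] at h1
    omega
  obtain ⟨hA, hB, hCc, hE, hF0⟩ := coeffs_eq_of_common_points hσl hS
    (A := F'.α * p ^ 2 + p * r + F'.β * r ^ 2 + F'.lam * u ^ 2)
    (B := F'.α * q ^ 2 + q * s + F'.β * s ^ 2 + F'.lam * w ^ 2)
    (C := F'.α * m ^ 2 + m * n + F'.β * n ^ 2 + F'.lam * c ^ 2) (D := p * s + q * r)
    (E := p * n + m * r) (F := q * n + m * s) fun t ht => by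
    refine ⟨z t, hz' t, ?_⟩
    have h1 := (Finset.mem_filter.1 ht).2
    rw [eval_semilinear F' f hp hq hm] at h1
    simp only [V, Matrix.cons_val, map_one, RingEquiv.apply_symm_apply] at h1
    linear_combination h1
  have heval : ∀ v, F'.eval (f v) = (p * s + q * r) * σ (F.eval v) := fun v => by
    rw [eval_semilinear F' f hp hq hm, hA, hB, hCc, hE, hF0]
    simp only [Conic.eval, map_add, map_mul, map_pow]
    ring
  -- Otherwise the form of F' would vanish on the whole plane, including (0,0,1).
  have hD : p * s + q * r ≠ 0 := fun h0 => by
    obtain ⟨x, hx⟩ := g.surjective (nucleus K)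
    induction x using Projectivization.ind with | h v hv =>
    refine nucleus_notMem_points (hlam F' hF') (hx ▸ ?_)
    rw [hg, mk_mem_points, heval, h0, zero_mul]
  -- The vanishing of E and F says that (m, n) solves a homogeneous system with determinant p s + q
  -- r.
  have hm0 : m = 0 := by
    have : (p * s + q * r) * m = 0 := by grind
    exact (mul_eq_zero.1 this).resolve_left hD
  have hn0 : n = 0 := by
    have : (p * s + q * r) * n = 0 := by grind
    exact (mul_eq_zero.1 this).resolve_left hD
  refine ⟨hD, hm0, hn0, F', hF', ?_, by simpa [hm0, hn0] using hCc, hA, hB⟩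
  exact image_points hg fun v => by simp [heval, hD]

/-- One matrix serves all conics of C, so the factor (p s + q r) / c^2 by which `lam` is scaled
after σ does not depend on the conic. -/
theorem IsCollineationWith.exists_coeffs [Finite K] [CharP K 2] (hcard : 128 ≤ Nat.card K)
    {σ : RingAut K} {g : Equiv.Perm (Point K)} (hg : IsCollineationWith σ g)
    {C C' : Set (Conic K)} (hne : C.Nonempty) (hClam : ∀ F ∈ C, F.lam ≠ 0)
    (hCfin : C'.Finite) (hC : C'.ncard ≤ 7) (hlam : ∀ F' ∈ C', F'.lam ≠ 0)
    (himg : g '' arc C ⊆ arc C') :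
    ∃ p q r s u w c : K, p * s + q * r ≠ 0 ∧ c ≠ 0 ∧
      ∀ F ∈ C, ∃ F' ∈ C', g '' F.points = F'.points ∧
      F'.lam * c ^ 2 = (p * s + q * r) * σ F.lam ∧
      F'.α * p ^ 2 + p * r + F'.β * r ^ 2 + F'.lam * u ^ 2 = (p * s + q * r) * σ F.α ∧
      F'.α * q ^ 2 + q * s + F'.β * s ^ 2 + F'.lam * w ^ 2 = (p * s + q * r) * σ F.β := by
  obtain ⟨f, hf, hg⟩ := isCollineationWith_iff.1 hg
  have hvec : ∀ v : Fin 3 → K, v = ![v 0, v 1, v 2] := fun v => by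
    ext i; fin_cases i <;> rfl
  have key := fun F (hF : F ∈ C) => exists_conic_eq_image hcard f hf hg (hvec _) (hvec _) (hvec _)
    (hClam F hF) hCfin hC hlam (subset_trans (Set.image_mono fun p hp =>
      mem_arc.2 (Or.inl ⟨F, hF, hp⟩)) himg)
  obtain ⟨F₀, hF₀⟩ := hne
  obtain ⟨hD, -, -, F', hF', -, hl, -⟩ := key F₀ hF₀
  refine ⟨_, _, _, _, _, _, _, hD, ?_, fun F hF => (key F hF).2.2.2⟩
  intro hc
  rw [hc] at hl
  have : σ F₀.lam = 0 := by simpa [hD] using hl.symm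
  exact hClam F₀ hF₀ (by simpa using this)

end Rigidity

/-! ### Change of coordinates to the arcs with given exponents -/

section Transport

variable {K : Type*} [Field K]

theorem IsMaximalArc.image {d : ℕ} {S : Set (Point K)} (hS : IsMaximalArc d S)
    {g : Equiv.Perm (Point K)} (hg : IsCollineation g) : IsMaximalArc d (g '' S) := by
  obtain ⟨hne, huniv, hline⟩ := hS
  obtain ⟨σ, hσ⟩ := hg
  obtain ⟨f, hf, hg⟩ := isCollineationWith_iff.1 hσ
  refine ⟨hne.image g, fun h => huniv ?_, fun u hu => ?_⟩
  · rw [← Set.preimage_image_eq S g.injective, h, Set.preimage_univ]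
  let e : Fin 3 → Fin 3 → K := ![![1, 0, 0], ![0, 1, 0], ![0, 0, 1]]
  -- The pullback of the line u: the transposed matrix applied to u, then the inverse of σ.
  let u' : Fin 3 → K := fun i =>
    σ.symm (f (e i) 0 * u 0 + f (e i) 1 * u 1 + f (e i) 2 * u 2)
  have hmem : ∀ p, g p ∈ line u ↔ p ∈ line u' := fun p => by
    induction p using Projectivization.ind with | h v hv =>
    have : f v 0 * u 0 + f v 1 * u 1 + f v 2 * u 2 =
        σ (v 0 * u' 0 + v 1 * u' 1 + v 2 * u' 2) := by
      rw [semilinear_apply f v 0, semilinear_apply f v 1, semilinear_apply f v 2]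
      simp only [map_add, map_mul, u', RingEquiv.apply_symm_apply, e, Matrix.cons_val]
      ring
    rw [hg, mk_mem_line, mk_mem_line, this, map_eq_zero]
  have hu' : u' ≠ 0 := fun h0 => by
    have hall : ∀ v hv, Projectivization.mk K v hv ∈ line u := fun v hv => by
      obtain ⟨p, hp⟩ := g.surjective (Projectivization.mk K v hv)
      rw [← hp, hmem, h0]
      simp [line]
    have h0 := hall ![1, 0, 0] (vec_ne_zero 0 (by simp))
    have h1 := hall ![0, 1, 0] (vec_ne_zero 1 (by simp))
    have h2 := hall ![0, 0, 1] (vec_ne_zero 2 (by simp))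
    rw [mk_mem_line] at h0 h1 h2
    simp at h0 h1 h2
    exact hu (by ext i; fin_cases i <;> simp [h0, h1, h2])
  have : g '' S ∩ line u = g '' (S ∩ line u') := by
    ext p
    constructor
    · rintro ⟨⟨q, hq, rfl⟩, hl⟩
      exact ⟨q, ⟨hq, (hmem q).1 hl⟩, rfl⟩
    · rintro ⟨q, ⟨hq, hl⟩, rfl⟩
      exact ⟨⟨q, hq, rfl⟩, (hmem q).2 hl⟩
  rw [this, Set.ncard_image_of_injective _ g.injective]
  exact hline u' hu'

variable [Finite K] [CharP K 2] {k : ℕ}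

/-- The conic `stdConic X` in the coordinates of the arcs with explicit exponents. -/
def coordConic (a X : K) : Conic K :=
  ⟨1 + a ^ 4 + a ^ 5 + (a ^ 2 + a ^ 3 + a ^ 4) * X + X ^ 3, 1, X / a ^ 2⟩

/-- For X = a^(2^i) the condition on j reads j = 2^i - 2, up to multiples of 127. This is the source
of the exponents -1, 0, 2, 6, 14, 30, 62. -/
theorem eq_coordConic {a X : K} (ha : a ≠ 0) {i j : ℤ}
    (hi : a ^ i = 1 + a ^ 4 + a ^ 5 + (a ^ 2 + a ^ 3 + a ^ 4) * X + X ^ 3)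
    (hj : a ^ (j + 2) = X) : ⟨a ^ i, 1, a ^ j⟩ = coordConic a X := by
  rw [coordConic, ← hi, ← hj, zpow_add₀ ha, zpow_ofNat, mul_div_cancel_right₀ _ (pow_ne_zero 2 ha)]

theorem exists_coordinate_change (hk : k = 1 ∨ k = 3) {a : K} (ha : a ∈ singerRoots K k) :
    ∃ g : Equiv.Perm (Point K), IsCollineationWith 1 g ∧ g (nucleus K) = nucleus K ∧
      ∀ X : K, g '' (stdConic X).points = (coordConic a X).points := by
  have ha0 := ne_zero_of_mem hk ha
  -- Adding r x to y contributes r^2 + r to the x^2-coefficient, cancelling a^4 + a^5; adding u x to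
  -- a z contributes X u^2 / a^2, cancelling the term linear in X.
  obtain ⟨r, hr⟩ : ∃ r : K, r ^ 2 + r = a ^ 4 + a ^ 5 := by
    simp only [singerRoots, Set.mem_ofPred_eq] at ha
    rcases hk with rfl | rfl
    · exact ⟨a + a ^ 4 + a ^ 6, by grind⟩
    · exact ⟨a + a ^ 2 + a ^ 3 + a ^ 4 + a ^ 5, by grind⟩
  obtain ⟨u, hu⟩ := exists_sq_eq ((a ^ 2 + a ^ 3 + a ^ 4) * a ^ 2)
  obtain ⟨g, hg⟩ := exists_perm_mk_eq (shearMap 1 r a u) (shearMap_ne_zero 1 r u ha0)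
  refine ⟨g, isCollineationWith_iff.2 ⟨_, _, hg⟩, ?_, fun X => image_points hg fun v => ?_⟩
  · conv_lhs => rw [nucleus]
    rw [hg]
    exact mk_eq_nucleus _ (by simp [shearMap]) (by simp [shearMap])
  · refine Eq.congr ?_ rfl
    simp only [Conic.eval, coordConic, stdConic, shearMap, LinearMap.coe_mk, AddHom.coe_mk,
      RingAut.one_apply, Matrix.cons_val]
    field_simp
    grind

theorem singerConics₁_eq {a : K} (ha : a ∈ singerRoots K 1) :
    singerConics₁ a = coordConic a '' singerRoots K 1 := by
  have hk : 1 = 1 ∨ 1 = 3 := Or.inl rfl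
  have ha0 := ne_zero_of_mem hk ha
  rw [← singerRoots_eq_image hk ha, Set.image_image]
  simp only [singerRoots, Set.mem_ofPred_eq, pow_one] at ha
  have h0 : (⟨a ^ (0 : ℤ), 1, a ^ (-1 : ℤ)⟩ : Conic K) = coordConic a (a ^ 2 ^ 0) := by
    refine eq_coordConic ha0 ?_ ?_ <;> norm_num only [zpow_ofNat, zpow_one, pow_one] <;> grind
  have h1 : (⟨a ^ (0 : ℤ), 1, a ^ (0 : ℤ)⟩ : Conic K) = coordConic a (a ^ 2 ^ 1) := by
    refine eq_coordConic ha0 ?_ ?_ <;> norm_num only [zpow_ofNat, zpow_one, pow_one] <;> grind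
  have h2 : (⟨a ^ (16 : ℤ), 1, a ^ (2 : ℤ)⟩ : Conic K) = coordConic a (a ^ 2 ^ 2) := by
    refine eq_coordConic ha0 ?_ ?_ <;> norm_num only [zpow_ofNat, zpow_one, pow_one] <;> grind
  have h3 : (⟨a ^ (0 : ℤ), 1, a ^ (6 : ℤ)⟩ : Conic K) = coordConic a (a ^ 2 ^ 3) := by
    refine eq_coordConic ha0 ?_ ?_ <;> norm_num only [zpow_ofNat, zpow_one, pow_one] <;> grind
  have h4 : (⟨a ^ (39 : ℤ), 1, a ^ (14 : ℤ)⟩ : Conic K) = coordConic a (a ^ 2 ^ 4) := by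
    refine eq_coordConic ha0 ?_ ?_ <;> norm_num only [zpow_ofNat, zpow_one, pow_one] <;> grind
  have h5 : (⟨a ^ (101 : ℤ), 1, a ^ (30 : ℤ)⟩ : Conic K) = coordConic a (a ^ 2 ^ 5) := by
    refine eq_coordConic ha0 ?_ ?_ <;> norm_num only [zpow_ofNat, zpow_one, pow_one] <;> grind
  have h6 : (⟨a ^ (93 : ℤ), 1, a ^ (62 : ℤ)⟩ : Conic K) = coordConic a (a ^ 2 ^ 6) := by
    refine eq_coordConic ha0 ?_ ?_ <;> norm_num only [zpow_ofNat, zpow_one, pow_one] <;> grind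
  ext F
  simp only [singerConics₁, conicsWithExponents, Set.mem_ofPred_eq, List.mem_cons,
    List.not_mem_nil, or_false, exists_eq_or_imp, exists_eq_left, h0, h1, h2, h3, h4, h5, h6,
    Set.mem_image, Finset.coe_range, Set.mem_Iio]
  constructor
  · rintro (h | h | h | h | h | h | h)
    exacts [⟨1, by simp, h.symm⟩, ⟨0, by simp, h.symm⟩, ⟨3, by simp, h.symm⟩, ⟨2, by simp, h.symm⟩,
      ⟨4, by simp, h.symm⟩, ⟨6, by simp, h.symm⟩, ⟨5, by simp, h.symm⟩]
  · rintro ⟨i, hi, rfl⟩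
    interval_cases i <;> simp

theorem singerConics₂_eq {a : K} (ha : a ∈ singerRoots K 3) :
    singerConics₂ a = coordConic a '' singerRoots K 3 := by
  have hk : 3 = 1 ∨ 3 = 3 := Or.inr rfl
  have ha0 := ne_zero_of_mem hk ha
  rw [← singerRoots_eq_image hk ha, Set.image_image]
  simp only [singerRoots, Set.mem_ofPred_eq] at ha
  have h0 : (⟨a ^ (0 : ℤ), 1, a ^ (-1 : ℤ)⟩ : Conic K) = coordConic a (a ^ 2 ^ 0) := by
    refine eq_coordConic ha0 ?_ ?_ <;> norm_num only [zpow_ofNat, zpow_one, pow_one] <;> grind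
  have h1 : (⟨a ^ (0 : ℤ), 1, a ^ (0 : ℤ)⟩ : Conic K) = coordConic a (a ^ 2 ^ 1) := by
    refine eq_coordConic ha0 ?_ ?_ <;> norm_num only [zpow_ofNat, zpow_one, pow_one] <;> grind
  have h2 : (⟨a ^ (18 : ℤ), 1, a ^ (2 : ℤ)⟩ : Conic K) = coordConic a (a ^ 2 ^ 2) := by
    refine eq_coordConic ha0 ?_ ?_ <;> norm_num only [zpow_ofNat, zpow_one, pow_one] <;> grind
  have h3 : (⟨a ^ (33 : ℤ), 1, a ^ (6 : ℤ)⟩ : Conic K) = coordConic a (a ^ 2 ^ 3) := by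
    refine eq_coordConic ha0 ?_ ?_ <;> norm_num only [zpow_ofNat, zpow_one, pow_one] <;> grind
  have h4 : (⟨a ^ (43 : ℤ), 1, a ^ (14 : ℤ)⟩ : Conic K) = coordConic a (a ^ 2 ^ 4) := by
    refine eq_coordConic ha0 ?_ ?_ <;> norm_num only [zpow_ofNat, zpow_one, pow_one] <;> grind
  have h5 : (⟨a ^ (0 : ℤ), 1, a ^ (30 : ℤ)⟩ : Conic K) = coordConic a (a ^ 2 ^ 5) := by
    refine eq_coordConic ha0 ?_ ?_ <;> norm_num only [zpow_ofNat, zpow_one, pow_one] <;> grind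
  have h6 : (⟨a ^ (12 : ℤ), 1, a ^ (62 : ℤ)⟩ : Conic K) = coordConic a (a ^ 2 ^ 6) := by
    refine eq_coordConic ha0 ?_ ?_ <;> norm_num only [zpow_ofNat, zpow_one, pow_one] <;> grind
  ext F
  simp only [singerConics₂, conicsWithExponents, Set.mem_ofPred_eq, List.mem_cons,
    List.not_mem_nil, or_false, exists_eq_or_imp, exists_eq_left, h0, h1, h2, h3, h4, h5, h6,
    Set.mem_image, Finset.coe_range, Set.mem_Iio]
  constructor
  · rintro (h | h | h | h | h | h | h)
    exacts [⟨1, by simp, h.symm⟩, ⟨0, by simp, h.symm⟩, ⟨5, by simp, h.symm⟩, ⟨2, by simp, h.symm⟩,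
      ⟨6, by simp, h.symm⟩, ⟨3, by simp, h.symm⟩, ⟨4, by simp, h.symm⟩]
  · rintro ⟨i, hi, rfl⟩
    interval_cases i <;> simp

/-- `C` is obtained from `stdConics K k` by the change of coordinates `g`. -/
def IsStdImage (k : ℕ) (g : Equiv.Perm (Point K)) (C : Set (Conic K)) : Prop :=
  IsCollineationWith 1 g ∧ g '' arc (stdConics K k) = arc C ∧
    conics C = (fun X => g '' (stdConic X).points) '' singerRoots K k

theorem exists_isStdImage (hk : k = 1 ∨ k = 3) {a : K} (ha : a ∈ singerRoots K k) {C : Set (Conic K)}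
    (hC : C = coordConic a '' singerRoots K k) : ∃ g, IsStdImage k g C := by
  obtain ⟨g, hg, hN, himg⟩ := exists_coordinate_change hk ha
  have hcon : conics C = (fun X => g '' (stdConic X).points) '' singerRoots K k := by
    rw [hC, conics, Set.image_image]
    exact Set.image_congr fun X _ => (himg X).symm
  refine ⟨g, hg, image_arc hN ?_, hcon⟩
  rw [hcon, conics, stdConics, Set.image_image, Set.image_image]

theorem exists_isStdImage₁ {a : K} (ha : 1 + a + a ^ 7 = 0) :
    ∃ g, IsStdImage 1 g (singerConics₁ a) := by
  have ha' : a ∈ singerRoots K 1 := by simpa [singerRoots] using ha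
  exact exists_isStdImage (Or.inl rfl) ha' (singerConics₁_eq ha')

theorem exists_isStdImage₂ {a : K} (ha : 1 + a ^ 3 + a ^ 7 = 0) :
    ∃ g, IsStdImage 3 g (singerConics₂ a) :=
  exists_isStdImage (Or.inr rfl) ha (singerConics₂_eq ha)

theorem IsStdImage.isomorphic {g : Equiv.Perm (Point K)} {C : Set (Conic K)}
    (hC : IsStdImage k g C) : Isomorphic (arc (stdConics K k)) (arc C) :=
  ⟨g, ⟨1, hC.1⟩, hC.2.1⟩

end Transport

/-! ### Non-isomorphism, non-Denniston type, and the case of 49 dividing h -/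

section Invariants

variable {K : Type*} [Field K] [Finite K] [Algebra (ZMod 2) K] {k h : ℕ}

theorem lam_ne_zero_of_mem_stdConics (hk : k = 1 ∨ k = 3) {F : Conic K}
    (hF : F ∈ stdConics K k) : F.lam ≠ 0 := by
  have := charP_two K
  obtain ⟨X, hX, rfl⟩ := hF
  exact ne_zero_of_mem hk hX

theorem stdConics_finite (K : Type*) [Field K] [Finite K] (k : ℕ) : (stdConics K k).Finite :=
  (Set.toFinite _).image _

theorem le_card (hcard : Nat.card K = 2 ^ h) (hodd : Odd h) (h7 : 7 ∣ h) : 128 ≤ Nat.card K := by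
  rw [hcard]
  exact Nat.pow_le_pow_right (n := 2) (by norm_num) (Nat.le_of_dvd hodd.pos h7)

theorem not_isomorphic_stdConics (hcard : Nat.card K = 2 ^ h) (hodd : Odd h) (h7 : 7 ∣ h) :
    ¬ Isomorphic (arc (stdConics K 3)) (arc (stdConics K 1)) := by
  have := charP_two K
  rintro ⟨g, ⟨σ, hσ⟩, himg⟩
  obtain ⟨a, ha⟩ := exists_mem_singerRoots (Or.inl rfl) hcard h7
  obtain ⟨b, hb⟩ := exists_mem_singerRoots (Or.inr rfl) hcard h7
  obtain ⟨p, q, r, s, u, w, c, hD, hc, hF⟩ := hσ.exists_coeffs (le_card hcard hodd h7)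
    (⟨_, b, hb, rfl⟩ : (stdConics K 3).Nonempty)
    (fun F hF => lam_ne_zero_of_mem_stdConics (Or.inr rfl) hF) (stdConics_finite K 1)
    (ncard_stdConics (Or.inl rfl) ha).le (fun F hF => lam_ne_zero_of_mem_stdConics (Or.inl rfl) hF)
    himg.subset
  -- Since σ permutes the roots for k = 3, scaling by this constant alone would map them into the
  -- roots for k = 1.
  refine not_forall_mul_mem hb ((p * s + q * r) / c ^ 2) fun X hX => ?_
  have hX' : σ.symm X ∈ singerRoots K 3 := by
    have : σ.symm (1 + X ^ 3 + X ^ 7) = 0 := by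
      rw [show 1 + X ^ 3 + X ^ 7 = 0 from hX, map_zero]
    simpa [singerRoots] using this
  obtain ⟨_, ⟨Y, hY, rfl⟩, -, hl, -⟩ := hF _ ⟨_, hX', rfl⟩
  simp only [stdConic, RingEquiv.apply_symm_apply] at hl
  have : (p * s + q * r) / c ^ 2 * X = Y := by
    rw [div_mul_eq_mul_div, div_eq_iff (pow_ne_zero 2 hc)]; exact hl.symm
  rwa [this]

/-- Gives a point of each conic other than the image of the nucleus, so that its preimage lies on a
conic of the source arc. -/
theorem exists_mem_stdConic_ne (hk : k = 1 ∨ k = 3) {X : K} (hX : X ∈ singerRoots K k)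
    (p : Point K) : ∃ p' ∈ (stdConic X).points, p' ≠ p := by
  have := charP_two K
  have hX0 := ne_zero_of_mem hk hX
  obtain ⟨y, hy⟩ := exists_sq_eq X
  obtain ⟨z, hz⟩ := exists_sq_eq ((1 + X ^ 3) / X)
  rw [eq_div_iff hX0] at hz
  have hne : Projectivization.mk K (![0, y, 1] : Fin 3 → K) (vec_ne_zero 2 (by simp)) ≠
      Projectivization.mk K ![1, 0, z] (vec_ne_zero 0 (by simp)) := by
    rw [Ne, Projectivization.mk_eq_mk_iff']
    rintro ⟨c, hc⟩
    have h0 := congrFun hc 0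
    have h2 := congrFun hc 2
    simp at h0 h2
    simp [h0] at h2
  by_cases hp : Projectivization.mk K (![0, y, 1] : Fin 3 → K) (vec_ne_zero 2 (by simp)) = p
  · refine ⟨_, ?_, fun h' => hne (hp.trans h'.symm)⟩
    rw [mk_mem_points]
    simp [Conic.eval, stdConic]
    grind
  · refine ⟨_, ?_, hp⟩
    rw [mk_mem_points]
    simp [Conic.eval, stdConic]
    grind

theorem not_isDennistonType_stdConics (hcard : Nat.card K = 2 ^ h) (hodd : Odd h) (h7 : 7 ∣ h)
    (hk : k = 1 ∨ k = 3) : ¬ IsDennistonType (arc (stdConics K k)) := by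
  have := charP_two K
  rintro ⟨α, A, -, g, ⟨σ, hσ⟩, himg⟩
  obtain ⟨a, ha⟩ := exists_mem_singerRoots hk hcard h7
  set C := {F : Conic K | F.α = α ∧ F.β = 1 ∧ F.lam ∈ A ∧ F.lam ≠ 0} with hC
  have hpre : ∀ X ∈ singerRoots K k, ∃ F ∈ C, ∃ p ∈ F.points, g p ∈ (stdConic X).points := by
    intro X hX
    obtain ⟨p', hp', hne⟩ := exists_mem_stdConic_ne hk hX (g (nucleus K))
    obtain ⟨p, hp, rfl⟩ : p' ∈ g '' arc C := by
      rw [himg]; exact mem_arc.2 (Or.inl ⟨_, ⟨X, hX, rfl⟩, hp'⟩)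
    rcases mem_arc.1 hp with ⟨F, hF, hpF⟩ | rfl
    · exact ⟨F, hF, p, hpF, hp'⟩
    · exact absurd rfl hne
  have hCne : C.Nonempty := by
    obtain ⟨F, hF, -⟩ := hpre a ha
    exact ⟨F, hF⟩
  obtain ⟨p, q, r, s, u, w, c, hD, hc, hF⟩ := hσ.exists_coeffs (le_card hcard hodd h7)
    hCne (fun F hF => hF.2.2.2) (stdConics_finite K k)
    (ncard_stdConics hk ha).le (fun F hF => lam_ne_zero_of_mem_stdConics hk hF)
    himg.subset
  have key : ∀ X ∈ singerRoots K k,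
      (1 + X ^ 3) * p ^ 2 + p * r + r ^ 2 + X * u ^ 2 = (p * s + q * r) * σ α ∧
      (1 + X ^ 3) * q ^ 2 + q * s + s ^ 2 + X * w ^ 2 = p * s + q * r := by
    intro X hX
    obtain ⟨F, hFC, x, hx, hgx⟩ := hpre X hX
    obtain ⟨_, ⟨Y, hY, rfl⟩, hFY, -, h1, h2⟩ := hF F hFC
    have hYX : Y = X := stdConic_disjoint hcard hodd hk hY hX (hFY ▸ ⟨x, hx, rfl⟩) hgx
    rw [hFC.1] at h1
    rw [hFC.2.1] at h2
    subst hYX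
    simp only [stdConic, one_mul, map_one, mul_one] at h1 h2
    exact ⟨h1, h2⟩
  -- The right-hand sides do not depend on X, so the X^3-coefficients p^2 and q^2 must vanish,
  -- making the determinant zero.
  obtain ⟨hp, -⟩ := cubic_eq_zero hk ha (A := p ^ 2) (B := 0) (C := u ^ 2)
    (D := p ^ 2 + p * r + r ^ 2 + (p * s + q * r) * σ α) fun X hX => by
      have := (key X hX).1
      grind
  obtain ⟨hq, -⟩ := cubic_eq_zero hk ha (A := q ^ 2) (B := 0) (C := w ^ 2)
    (D := q ^ 2 + q * s + s ^ 2 + (p * s + q * r)) fun X hX => by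
      have := (key X hX).2
      grind
  rw [sq_eq_zero_iff] at hp hq
  simp [hp, hq] at hD

/-- If `49` divides `h`, then a collineation of order `1` or `7` which stabilises the standard arc
stabilises each of its conics. -/
theorem image_stdConic_eq_self (hcard : Nat.card K = 2 ^ h) (hodd : Odd h) (h49 : 49 ∣ h)
    (hk : k = 1 ∨ k = 3) {g : Equiv.Perm (Point K)} (hg : IsCollineation g) (hg7 : g ^ 7 = 1)
    (himg : g '' arc (stdConics K k) = arc (stdConics K k)) {X : K} (hX : X ∈ singerRoots K k) :
    g '' (stdConic X).points = (stdConic X).points := by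
  have := charP_two K
  have h7 : 7 ∣ h := (by norm_num : 7 ∣ 49).trans h49
  obtain ⟨σ, hσ⟩ := hg
  have hσ7 : σ ^ 7 = 1 := (hg7 ▸ hσ.pow 7).eq_one
  obtain ⟨j, hj⟩ := exists_ringAut_eq_pow σ
  rw [ringAut_pow_eq_one_iff hcard hj] at hσ7
  -- From σ^7 = 1 follows h ∣ 7j, so 49 ∣ 7j; hence σ is trivial on GF(2^7).
  obtain ⟨i, rfl⟩ : 7 ∣ j := by
    have : 49 ∣ j * 7 := h49.trans hσ7
    omega
  have hfix : ∀ Y ∈ singerRoots K k, σ Y = Y := fun Y hY => by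
    rw [hj]; exact pow_two_pow_eq_self (pow_128_eq_self hk hY) i
  obtain ⟨p, q, r, s, u, w, c, hD, hc, hF⟩ := hσ.exists_coeffs (le_card hcard hodd h7)
    (⟨_, X, hX, rfl⟩ : (stdConics K k).Nonempty) (fun F hF => lam_ne_zero_of_mem_stdConics hk hF) (stdConics_finite K k)
    (ncard_stdConics hk hX).le (fun F hF => lam_ne_zero_of_mem_stdConics hk hF)
    himg.subset
  have hscale : ∀ Y ∈ singerRoots K k, ∃ Z ∈ singerRoots K k,
      g '' (stdConic Y).points = (stdConic Z).points ∧ (p * s + q * r) / c ^ 2 * Y = Z := by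
    intro Y hY
    obtain ⟨_, ⟨Z, hZ, rfl⟩, hYZ, hl, -⟩ := hF _ ⟨Y, hY, rfl⟩
    simp only [stdConic, hfix Y hY] at hl
    exact ⟨Z, hZ, hYZ, by
      rw [div_mul_eq_mul_div, div_eq_iff (pow_ne_zero 2 hc)]; exact hl.symm⟩
  have hone : (p * s + q * r) / c ^ 2 = 1 := eq_one_of_mul_mem hk hX fun Y hY => by
    obtain ⟨Z, hZ, -, hYZ⟩ := hscale Y hY
    rwa [hYZ]
  obtain ⟨Z, hZ, hXZ, hl⟩ := hscale X hX
  rw [hXZ, ← hl, hone, one_mul]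

end Invariants

/-! ### The cyclic groups and their action on the conics -/

section SingerGroup

variable {K : Type*} [Field K] {k h : ℕ}

theorem image_one (S : Set (Point K)) : (1 : Equiv.Perm (Point K)) '' S = S := Set.image_id S

theorem image_mul (g g' : Equiv.Perm (Point K)) (S : Set (Point K)) :
    (g * g') '' S = g '' (g' '' S) := by
  rw [Equiv.Perm.coe_mul, Set.image_comp]

theorem image_pow_eq_self {g : Equiv.Perm (Point K)} {S : Set (Point K)} (hg : g '' S = S) (n : ℕ) :
    (g ^ n) '' S = S := by
  induction n with
  | zero => exact image_one S
  | succ n ih => rw [pow_succ, image_mul, hg, ih]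

theorem exists_nat_pow_of_mem_zpowers [Finite K] {θ g : Equiv.Perm (Point K)}
    (hg : g ∈ Subgroup.zpowers θ) : ∃ n : ℕ, θ ^ n = g := by
  have : Finite (Point K) := Quotient.finite _
  exact Submonoid.mem_powers_iff _ _ |>.1 (mem_powers_iff_mem_zpowers.2 hg)

theorem pow_two_pow_mod {x : K} (hx : x ^ 2 ^ 7 = x) (n : ℕ) : x ^ 2 ^ n = x ^ 2 ^ (n % 7) := by
  conv_lhs => rw [← Nat.div_add_mod n 7, pow_add, pow_mul, pow_two_pow_eq_self hx]

/-- The collineation which applies a field automorphism to the coordinates. -/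
theorem exists_coordinatewise [Finite K] [CharP K 2] (hk : k = 1 ∨ k = 3) {τ : RingAut K}
    (hτ : ActsAsSquaring τ) :
    ∃ θ : Equiv.Perm (Point K), IsCollineationWith τ θ ∧ (∀ n : ℕ, θ ^ n = 1 ↔ τ ^ n = 1) ∧
      θ '' arc (stdConics K k) = arc (stdConics K k) ∧
      ∀ X ∈ singerRoots K k, ∀ n : ℕ,
        (θ ^ n) '' (stdConic X).points = (stdConic (X ^ 2 ^ n)).points ∧
        ((∀ p ∈ (stdConic X).points, (θ ^ n) p = p) → θ ^ n = 1) := by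
  obtain ⟨θ, hθ⟩ := exists_perm_mk_eq (shearMap τ 0 1 0) (shearMap_ne_zero τ 0 0 one_ne_zero)
  have hcol : IsCollineationWith τ θ := isCollineationWith_iff.2 ⟨_, _, hθ⟩
  have hmap : ∀ v, shearMap τ 0 1 0 v = fun i => τ (v i) := fun v => by
    ext i; fin_cases i <;> simp [shearMap]
  have hpow : ∀ n : ℕ, ∀ v hv, ∃ hv', (θ ^ n) (Projectivization.mk K v hv) =
      Projectivization.mk K (fun i => (τ ^ n) (v i)) hv' := by
    intro n
    induction n with
    | zero => exact fun v hv => ⟨hv, rfl⟩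
    | succ n ih =>
      intro v hv
      obtain ⟨hv', h'⟩ := ih _ (shearMap_ne_zero τ 0 0 one_ne_zero v hv)
      have : (fun i => (τ ^ (n + 1)) (v i)) = fun i => (τ ^ n) (shearMap τ 0 1 0 v i) := by
        rw [hmap]; rfl
      simp only [this]
      exact ⟨hv', by rw [pow_succ, Equiv.Perm.mul_apply, hθ, h']⟩
  have hone : ∀ n : ℕ, τ ^ n = 1 → θ ^ n = 1 := fun n hn => by
    ext p
    induction p using Projectivization.ind with | h v hv =>
    obtain ⟨hv', h'⟩ := hpow n v hv
    rw [h']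
    simp [hn]
  have himg : ∀ X ∈ singerRoots K k,
      θ '' (stdConic X).points = (stdConic (X ^ 2)).points := fun X hX =>
    image_points hθ fun v => by
      have : (stdConic (X ^ 2)).eval (shearMap τ 0 1 0 v) = τ ((stdConic X).eval v) := by
        rw [← hτ X (pow_128_eq_self hk hX), hmap]
        simp [Conic.eval, stdConic]
      rw [this, map_eq_zero]
  refine ⟨θ, hcol, fun n => ⟨fun hn => (hn ▸ hcol.pow n).eq_one, hone n⟩, image_arc ?_ ?_,
    fun X hX n => ⟨?_, fun hfix => hone n ?_⟩⟩
  · conv_lhs => rw [nucleus]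
    rw [hθ]
    exact mk_eq_nucleus _ (by simp [shearMap]) (by simp [shearMap])
  · simp only [conics, stdConics, Set.image_image]
    ext S
    constructor
    · rintro ⟨X, hX, rfl⟩
      exact ⟨X ^ 2, sq_mem hX, (himg X hX).symm⟩
    · rintro ⟨X, hX, rfl⟩
      -- The inverse of squaring on GF(2^7) is the 64th power.
      refine ⟨X ^ 2 ^ 6, pow_two_pow_mem hX 6, ?_⟩
      simp only [himg _ (pow_two_pow_mem hX 6), ← pow_mul, ← pow_succ, pow_128_eq_self hk hX]
  · induction n with
    | zero => rw [pow_zero, image_one]; simp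
    | succ n ih =>
      rw [pow_succ', image_mul, ih, himg _ (pow_two_pow_mem hX n), ← pow_mul, ← pow_succ]
  · ext t
    have hX0 := ne_zero_of_mem hk hX
    -- Every t occurs as y-coordinate of a point (1, t, z) of the conic, so fixing the conic
    -- pointwise makes τ^n fix all of K.
    obtain ⟨z, hz⟩ := exists_sq_eq ((1 + X ^ 3 + t + t ^ 2) / X)
    rw [eq_div_iff hX0] at hz
    have hne : (![1, t, z] : Fin 3 → K) ≠ 0 := vec_ne_zero 0 (by simp)
    have hmem : Projectivization.mk K _ hne ∈ (stdConic X).points := by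
      rw [mk_mem_points]
      simp [Conic.eval, stdConic]
      grind
    obtain ⟨hv', h'⟩ := hpow n _ hne
    rw [hfix _ hmem, Projectivization.mk_eq_mk_iff'] at h'
    obtain ⟨c, hc⟩ := h'
    have h0 := congrFun hc 0
    have h1 := congrFun hc 1
    simp at h0 h1
    simpa [h0] using h1

/-- The generator of the Singer group of an arc obtained from `stdConics K k` by the change of
coordinates `g`. -/
theorem exists_singer_generator [Finite K] [CharP K 2] (hk : k = 1 ∨ k = 3) {τ : RingAut K}
    (hτ : ActsAsSquaring τ) {g : Equiv.Perm (Point K)} {C : Set (Conic K)}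
    (hC : IsStdImage k g C) :
    ∃ θ : Equiv.Perm (Point K), IsCollineationWith τ θ ∧ orderOf θ = orderOf τ ∧
      θ '' arc C = arc C ∧
      ∀ X ∈ singerRoots K k, ∀ n : ℕ,
        (θ ^ n) '' (g '' (stdConic X).points) = g '' (stdConic (X ^ 2 ^ n)).points ∧
        ((∀ p ∈ g '' (stdConic X).points, (θ ^ n) p = p) → θ ^ n = 1) := by
  obtain ⟨θ, hθ, hone, harc, hX⟩ := exists_coordinatewise (k := k) hk hτ
  obtain ⟨hg, hgC, -⟩ := hC
  have hpow : ∀ n : ℕ, (g * θ * g⁻¹) ^ n = g * θ ^ n * g⁻¹ := fun n => conj_pow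
  refine ⟨g * θ * g⁻¹, by simpa using (hg.mul hθ).mul hg.inv, ?_, ?_, fun X hX' n => ⟨?_, ?_⟩⟩
  · refine Nat.dvd_antisymm ?_ ?_ <;> rw [orderOf_dvd_iff_pow_eq_one]
    · rw [hpow, (hone _).2 (pow_orderOf_eq_one τ)]; group
    · rw [← hone]
      have := pow_orderOf_eq_one (g * θ * g⁻¹)
      rwa [hpow, conj_eq_one_iff] at this
  · rw [← hgC, ← image_mul, inv_mul_cancel_right, image_mul, harc]
  · rw [hpow, ← image_mul, inv_mul_cancel_right, image_mul, (hX X hX' n).1]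
  · intro hfix
    rw [hpow, conj_eq_one_iff]
    refine (hX X hX' n).2 fun p hp => g.injective ?_
    have := hfix (g p) ⟨p, hp, rfl⟩
    rw [hpow] at this
    simpa using this

theorem isAutGroup_and_transitive [Finite K] [CharP K 2] (hk : k = 1 ∨ k = 3) {τ : RingAut K}
    {g θ : Equiv.Perm (Point K)} {C : Set (Conic K)} (hC : IsStdImage k g C)
    (hθ : IsCollineationWith τ θ) (harc : θ '' arc C = arc C)
    (hX : ∀ X ∈ singerRoots K k, ∀ n : ℕ,
      (θ ^ n) '' (g '' (stdConic X).points) = g '' (stdConic (X ^ 2 ^ n)).points) :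
    IsAutGroup (Subgroup.zpowers θ) (arc C) (conics C) ∧
      Transitive (Subgroup.zpowers θ) (conics C) := by
  rw [hC.2.2]
  constructor
  · intro γ hγ
    obtain ⟨n, rfl⟩ := exists_nat_pow_of_mem_zpowers hγ
    refine ⟨⟨_, hθ.pow n⟩, image_pow_eq_self harc n, ?_⟩
    rintro _ ⟨X, hX', rfl⟩
    exact ⟨_, pow_two_pow_mem hX' n, (hX X hX' n).symm⟩
  · rintro _ ⟨X, hX', rfl⟩ _ ⟨Y, hY, rfl⟩
    obtain ⟨n, rfl⟩ := exists_eq_pow hk hX' hY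
    exact ⟨θ ^ n, Subgroup.npow_mem_zpowers θ n, hX X hX' n⟩

theorem eq_of_image_stdConic_eq [Finite K] [Algebra (ZMod 2) K] (hcard : Nat.card K = 2 ^ h)
    (hodd : Odd h) (hk : k = 1 ∨ k = 3) {g : Equiv.Perm (Point K)} {X Y : K}
    (hX : X ∈ singerRoots K k) (hY : Y ∈ singerRoots K k)
    (hXY : g '' (stdConic X).points = g '' (stdConic Y).points) : X = Y :=
  stdConic_injective (points_injOn_stdConics hcard hodd hk ⟨X, hX, rfl⟩ ⟨Y, hY, rfl⟩
    (g.injective.image_injective hXY))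

theorem ncard_conics_eq_seven [Finite K] [Algebra (ZMod 2) K] [CharP K 2]
    (hcard : Nat.card K = 2 ^ h) (hodd : Odd h) (hk : k = 1 ∨ k = 3) {a : K}
    (ha : a ∈ singerRoots K k) {g : Equiv.Perm (Point K)} {C : Set (Conic K)}
    (hC : IsStdImage k g C) : (conics C).ncard = 7 := by
  have hinj : Set.InjOn (fun X => g '' (stdConic X).points) (singerRoots K k) :=
    fun X hX Y hY hXY => eq_of_image_stdConic_eq hcard hodd hk hX hY hXY
  rw [hC.2.2, hinj.ncard_image, singerRoots_ncard hk ha]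

theorem isMathonArc_of_isStdImage [Finite K] [Algebra (ZMod 2) K] [CharP K 2]
    (hcard : Nat.card K = 2 ^ h) (hodd : Odd h) (hk : k = 1 ∨ k = 3) {a : K}
    (ha : a ∈ singerRoots K k) {g : Equiv.Perm (Point K)} {C : Set (Conic K)}
    (hC : IsStdImage k g C) : IsMathonArc 8 (arc C) (conics C) := by
  refine ⟨?_, by rw [ncard_conics_eq_seven hcard hodd hk ha hC], stdConics K k,
    isClosedSet_stdConics hcard hodd hk, by rw [ncard_stdConics hk ha], g, ⟨1, hC.1⟩,
    hC.2.1.symm, ?_⟩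
  · rw [← hC.2.1]
    exact (isMaximalArc_stdConics hcard hodd hk ha).image ⟨1, hC.1⟩
  · rw [hC.2.2, conics, stdConics, Set.image_image, Set.image_image]

/-- The image of a conic under θ^n determines n modulo 7, and θ has order 7. -/
theorem sharplyTransitive_zpowers [Finite K] [Algebra (ZMod 2) K] [CharP K 2]
    (hcard : Nat.card K = 2 ^ h) (hodd : Odd h) (hk : k = 1 ∨ k = 3)
    {g θ : Equiv.Perm (Point K)} {C : Set (Conic K)} (hC : IsStdImage k g C)
    (hord : orderOf θ = 7) (htrans : Transitive (Subgroup.zpowers θ) (conics C))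
    (hX : ∀ X ∈ singerRoots K k, ∀ n : ℕ,
      (θ ^ n) '' (g '' (stdConic X).points) = g '' (stdConic (X ^ 2 ^ n)).points) :
    SharplyTransitive (Subgroup.zpowers θ) (conics C) := by
  intro S hS T hT
  obtain ⟨γ, hγ, hγS⟩ := htrans S hS T hT
  refine ⟨γ, ⟨hγ, hγS⟩, ?_⟩
  rintro γ' ⟨hγ', hγS'⟩
  obtain ⟨n, rfl⟩ := exists_nat_pow_of_mem_zpowers hγ
  obtain ⟨m, rfl⟩ := exists_nat_pow_of_mem_zpowers hγ'
  rw [hC.2.2] at hS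
  obtain ⟨X, hX', rfl⟩ := hS
  simp only [hX X hX'] at hγS hγS'
  have h1 := eq_of_image_stdConic_eq hcard hodd hk (pow_two_pow_mem hX' m) (pow_two_pow_mem hX' n)
    (hγS'.trans hγS.symm)
  have h128 := pow_128_eq_self hk hX'
  rw [pow_two_pow_mod h128 m, pow_two_pow_mod h128 n] at h1
  have h2 := pow_two_pow_injOn hk hX' (by simpa using Nat.mod_lt m (by norm_num))
    (by simpa using Nat.mod_lt n (by norm_num)) h1
  rw [← pow_mod_orderOf, ← pow_mod_orderOf θ n, hord, h2]

/-- A finite cyclic group whose order is divisible by `d` has exactly one subgroup of order `d`. -/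
theorem existsUnique_subgroup_zpowers {G : Type*} [Group G] [Finite G] (x : G) {d : ℕ} (hd : 0 < d)
    (hdvd : d ∣ orderOf x) : ∃! H : Subgroup G, H ≤ Subgroup.zpowers x ∧ Nat.card H = d := by
  obtain ⟨e, he⟩ := hdvd
  have he0 : e ≠ 0 := by
    rintro rfl
    exact (orderOf_pos x).ne' (by simpa using he)
  have hcard : Nat.card (Subgroup.zpowers (x ^ e)) = d := by
    rw [Nat.card_zpowers, orderOf_pow_of_dvd he0 (he ▸ Dvd.intro_left d rfl), he,
      Nat.mul_div_cancel _ (Nat.pos_of_ne_zero he0)]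
  refine ⟨Subgroup.zpowers (x ^ e), ⟨?_, hcard⟩, ?_⟩
  · rw [Subgroup.zpowers_le]
    exact Subgroup.npow_mem_zpowers x e
  · rintro H ⟨hH, hHd⟩
    refine Subgroup.eq_of_le_of_card_ge (fun y hy => ?_) (by rw [hcard, hHd])
    obtain ⟨n, rfl⟩ : ∃ n : ℕ, x ^ n = y :=
      Submonoid.mem_powers_iff _ _ |>.1 (mem_powers_iff_mem_zpowers.2 (hH hy))
    have hyd : (x ^ n) ^ d = 1 := by
      have := pow_card_eq_one' (x := (⟨_, hy⟩ : H))
      rw [hHd] at this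
      exact congrArg Subtype.val this
    rw [← pow_mul, ← orderOf_dvd_iff_pow_eq_one, he, mul_comm n d] at hyd
    obtain ⟨m, rfl⟩ := Nat.dvd_of_mul_dvd_mul_left hd hyd
    rw [pow_mul]
    exact Subgroup.npow_mem_zpowers _ m

theorem fixes_conics_of_card_eq_seven [Finite K] [CharP K 2] (hk : k = 1 ∨ k = 3)
    {g θ : Equiv.Perm (Point K)} {C : Set (Conic K)} (hC : IsStdImage k g C)
    (hord : 49 ∣ orderOf θ)
    (hX : ∀ X ∈ singerRoots K k, ∀ n : ℕ,
      (θ ^ n) '' (g '' (stdConic X).points) = g '' (stdConic (X ^ 2 ^ n)).points ∧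
      ((∀ p ∈ g '' (stdConic X).points, (θ ^ n) p = p) → θ ^ n = 1))
    {H : Subgroup (Equiv.Perm (Point K))} (hH : H ≤ Subgroup.zpowers θ) (hH7 : Nat.card H = 7)
    {γ : Equiv.Perm (Point K)} (hγ : γ ∈ H) {S : Set (Point K)} (hS : S ∈ conics C) :
    γ '' S = S ∧ (γ ≠ 1 → ∃ p ∈ S, γ p ≠ p) := by
  have hγ7 : γ ^ 7 = 1 := by
    have := pow_card_eq_one' (x := (⟨_, hγ⟩ : H))
    rw [hH7] at this
    exact congrArg Subtype.val this
  obtain ⟨n, rfl⟩ := exists_nat_pow_of_mem_zpowers (hH hγ)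
  rw [hC.2.2] at hS
  obtain ⟨X, hX', rfl⟩ := hS
  rw [← pow_mul, ← orderOf_dvd_iff_pow_eq_one] at hγ7
  -- 49 divides the order of θ, which divides 7n. So θ^n sends X to X^(2^n) = X.
  obtain ⟨m, rfl⟩ : 7 ∣ n := by
    have := hord.trans hγ7
    omega
  refine ⟨?_, fun hne => ?_⟩
  · simp only [(hX X hX' _).1, pow_two_pow_eq_self (pow_128_eq_self hk hX') m]
  · by_contra! hcon
    exact hne ((hX X hX' _).2 hcon)

theorem sq_ne_self [CharP K 2] (hk : k = 1 ∨ k = 3) {a : K} (ha : a ∈ singerRoots K k) :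
    a ^ 2 ≠ a := fun h1 => by
  have h2 : a * (a - 1) = 0 := by linear_combination h1
  rcases mul_eq_zero.1 h2 with h0 | h0
  · exact ne_zero_of_mem hk ha h0
  · exact ne_one_of_mem ha (sub_eq_zero.1 h0)

theorem not_sharplyTransitive [Finite K] [Algebra (ZMod 2) K] [CharP K 2]
    (hcard : Nat.card K = 2 ^ h) (hodd : Odd h) (h49 : 49 ∣ h) (hk : k = 1 ∨ k = 3) {a : K}
    (ha : a ∈ singerRoots K k) {g : Equiv.Perm (Point K)} {C : Set (Conic K)}
    (hC : IsStdImage k g C) {G : Subgroup (Equiv.Perm (Point K))}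
    (hG : IsAutGroup G (arc C) (conics C)) : ¬ SharplyTransitive G (conics C) := by
  intro hsharp
  have hmem : ∀ X ∈ singerRoots K k, g '' (stdConic X).points ∈ conics C := fun X hX => by
    rw [hC.2.2]; exact ⟨X, hX, rfl⟩
  -- Sharp transitivity makes the orbit map at one conic a bijection from G to the seven conics.
  have hGcard : Nat.card G = 7 := by
    rw [← ncard_conics_eq_seven hcard hodd hk ha hC, ← Nat.card_coe_set_eq]
    refine Nat.card_congr (Equiv.ofBijective (fun γ : G => (⟨(γ : Equiv.Perm (Point K)) ''
      (g '' (stdConic a).points), (hG _ γ.2).2.2 _ (hmem a ha)⟩ : conics C)) ⟨?_, ?_⟩)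
    · intro γ γ' hγ
      exact Subtype.ext ((hsharp _ (hmem a ha) _ ((hG _ γ'.2).2.2 _ (hmem a ha))).unique
        ⟨γ.2, congrArg Subtype.val hγ⟩ ⟨γ'.2, rfl⟩)
    · rintro ⟨S, hS⟩
      obtain ⟨γ, ⟨hγ, hγS⟩, -⟩ := hsharp _ (hmem a ha) S hS
      exact ⟨⟨γ, hγ⟩, Subtype.ext hγS⟩
  obtain ⟨γ, ⟨hγ, hγS⟩, -⟩ := hsharp _ (hmem a ha) _ (hmem _ (sq_mem ha))
  have hγ7 : γ ^ 7 = 1 := by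
    have := pow_card_eq_one' (x := (⟨_, hγ⟩ : G))
    rw [hGcard] at this
    exact congrArg Subtype.val this
  have hcol : IsCollineation (g⁻¹ * γ * g) :=
    ((IsCollineation.inv ⟨1, hC.1⟩).mul (hG γ hγ).1).mul ⟨1, hC.1⟩
  have hconj : (g⁻¹ * γ * g) ^ 7 = 1 := by
    have : (g⁻¹ * γ * g⁻¹⁻¹) ^ 7 = g⁻¹ * γ ^ 7 * g⁻¹⁻¹ := conj_pow
    rw [inv_inv, hγ7] at this
    rw [this]; group
  have harc : (g⁻¹ * γ * g) '' arc (stdConics K k) = arc (stdConics K k) := by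
    rw [image_mul, image_mul, hC.2.1, (hG γ hγ).2.1, ← hC.2.1, ← image_mul, inv_mul_cancel,
      image_one]
  have hfix := image_stdConic_eq_self hcard hodd h49 hk hcol hconj harc ha
  rw [image_mul, image_mul, hγS, ← image_mul, inv_mul_cancel, image_one] at hfix
  exact sq_ne_self hk ha (eq_of_image_stdConic_eq (g := 1) hcard hodd hk (sq_mem ha) ha
    (by rw [hfix]))

theorem actsAsSquaring_of_mod [Finite K] {τ : RingAut K} {j : ℕ} (hτ : ∀ x, τ x = x ^ 2 ^ j)
    (hj : j % 7 = 1) : ActsAsSquaring τ := fun x hx => by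
  rw [hτ, pow_two_pow_mod hx, hj, pow_one]

theorem exists_actsAsSquaring [Finite K] [CharP K 2] : ∃ τ : RingAut K, ActsAsSquaring τ := by
  obtain ⟨τ, hτ⟩ := exists_ringAut_pow (K := K) 1
  exact ⟨τ, actsAsSquaring_of_mod hτ rfl⟩

theorem exists_actsAsSquaring_orderOf_eq_seven [Finite K] [Algebra (ZMod 2) K]
    (hcard : Nat.card K = 2 ^ h) (h7 : 7 ∣ h) (h49 : ¬ 49 ∣ h) :
    ∃ τ : RingAut K, ActsAsSquaring τ ∧ orderOf τ = 7 := by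
  have := charP_two K
  obtain ⟨m, rfl⟩ := h7
  have hco : Nat.Coprime 7 m := by
    rw [Nat.Prime.coprime_iff_not_dvd (by norm_num)]
    rintro ⟨n, rfl⟩
    exact h49 ⟨n, by ring⟩
  -- With h = 7m: j ≡ 1 mod 7 gives squaring on GF(2^7), and m ∣ j gives τ^7 = 1. Such j exists
  -- because 49 does not divide h.
  obtain ⟨j, hj1, hj0⟩ := Nat.chineseRemainder hco 1 0
  obtain ⟨τ, hτ⟩ := exists_ringAut_pow (K := K) j
  have hsq : ActsAsSquaring τ := actsAsSquaring_of_mod hτ hj1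
  have : Fact (Nat.Prime 7) := ⟨by norm_num⟩
  refine ⟨τ, hsq, orderOf_eq_prime ?_ ?_⟩
  · rw [ringAut_pow_eq_one_iff hcard hτ, mul_comm j]
    exact Nat.mul_dvd_mul_left 7 ((Nat.modEq_zero_iff_dvd).1 hj0)
  · rintro rfl
    obtain ⟨a, ha⟩ := exists_mem_singerRoots (k := 1) (Or.inl rfl) hcard (dvd_mul_right 7 m)
    exact sq_ne_self (Or.inl rfl) ha (hsq a (pow_128_eq_self (Or.inl rfl) ha)).symm

theorem dvd_orderOf_of_actsAsSquaring [Finite K] [Algebra (ZMod 2) K]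
    (hcard : Nat.card K = 2 ^ h) (h49 : 49 ∣ h) {τ : RingAut K} (hτ : ActsAsSquaring τ) :
    49 ∣ orderOf τ := by
  have := charP_two K
  have h7 : 7 ∣ h := (by norm_num : 7 ∣ 49).trans h49
  obtain ⟨j, hj⟩ := exists_ringAut_eq_pow τ
  obtain ⟨a, ha⟩ := exists_mem_singerRoots (k := 1) (Or.inl rfl) hcard h7
  have ha128 := pow_128_eq_self (Or.inl rfl) ha
  -- If 7 divided j, τ would be trivial on GF(2^7). So 49 ∣ h ∣ j · `orderOf τ` puts 49 into the
  -- order.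
  have hj7 : Nat.Coprime (7 ^ 2) j := by
    refine Nat.Coprime.pow_left 2 ((Nat.Prime.coprime_iff_not_dvd (by norm_num)).2 ?_)
    rintro ⟨i, rfl⟩
    have := hτ a ha128
    rw [hj, pow_two_pow_eq_self ha128] at this
    exact sq_ne_self (Or.inl rfl) ha this.symm
  have h1 := (ringAut_pow_eq_one_iff hcard hj (orderOf τ)).1 (pow_orderOf_eq_one τ)
  exact hj7.dvd_of_dvd_mul_left (h49.trans h1)

end SingerGroup

end MathonArcs

theorem mainTheorem5 {K : Type*} [Field K] [Finite K] [Algebra (ZMod 2) K] (h : ℕ)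
    (hcard : Nat.card K = 2 ^ h) (hodd : Odd h) (h7 : 7 ∣ h) :
    -- both arcs are defined over `K`
    (∃ a : K, orderOf a = 2 ^ 7 - 1 ∧ 1 + a + a ^ 7 = 0) ∧
    (∃ a : K, orderOf a = 2 ^ 7 - 1 ∧ 1 + a ^ 3 + a ^ 7 = 0) ∧
    -- up to isomorphism they do not depend on the choice of `a`, and they are not isomorphic
    (∀ a b : K, 1 + a + a ^ 7 = 0 → 1 + b + b ^ 7 = 0 →
      MathonArcs.Isomorphic (MathonArcs.arc (MathonArcs.singerConics₁ a))
        (MathonArcs.arc (MathonArcs.singerConics₁ b))) ∧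
    (∀ a b : K, 1 + a ^ 3 + a ^ 7 = 0 → 1 + b ^ 3 + b ^ 7 = 0 →
      MathonArcs.Isomorphic (MathonArcs.arc (MathonArcs.singerConics₂ a))
        (MathonArcs.arc (MathonArcs.singerConics₂ b))) ∧
    (∀ a b : K, 1 + a + a ^ 7 = 0 → 1 + b ^ 3 + b ^ 7 = 0 →
      ¬ MathonArcs.Isomorphic (MathonArcs.arc (MathonArcs.singerConics₁ a))
        (MathonArcs.arc (MathonArcs.singerConics₂ b))) ∧
    -- the properties of the arcs of both families
    ∀ C : Set (MathonArcs.Conic K),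
      ((∃ a : K, 1 + a + a ^ 7 = 0 ∧ C = MathonArcs.singerConics₁ a) ∨
        (∃ a : K, 1 + a ^ 3 + a ^ 7 = 0 ∧ C = MathonArcs.singerConics₂ a)) →
      MathonArcs.IsMathonArc 8 (MathonArcs.arc C) (MathonArcs.conics C) ∧
      ¬ MathonArcs.IsDennistonType (MathonArcs.arc C) ∧
      -- Singer arcs
      (¬ 49 ∣ h →
        ∃ τ : RingAut K, MathonArcs.ActsAsSquaring τ ∧ orderOf τ = 7 ∧
          ∃ θ : Equiv.Perm (MathonArcs.Point K), MathonArcs.IsCollineationWith τ θ ∧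
            orderOf θ = 7 ∧
            MathonArcs.IsAutGroup (Subgroup.zpowers θ) (MathonArcs.arc C)
              (MathonArcs.conics C) ∧
            MathonArcs.SharplyTransitive (Subgroup.zpowers θ) (MathonArcs.conics C)) ∧
      -- Singer arcs of the second kind
      (49 ∣ h →
        (∃ τ : RingAut K, MathonArcs.ActsAsSquaring τ) ∧
        (∀ τ : RingAut K, MathonArcs.ActsAsSquaring τ →
          49 ∣ orderOf τ ∧
          ∃ θ : Equiv.Perm (MathonArcs.Point K), MathonArcs.IsCollineationWith τ θ ∧
            MathonArcs.IsAutGroup (Subgroup.zpowers θ) (MathonArcs.arc C)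
              (MathonArcs.conics C) ∧
            MathonArcs.Transitive (Subgroup.zpowers θ) (MathonArcs.conics C) ∧
            (∃! H : Subgroup (Equiv.Perm (MathonArcs.Point K)),
              H ≤ Subgroup.zpowers θ ∧ Nat.card H = 7) ∧
            ∀ H : Subgroup (Equiv.Perm (MathonArcs.Point K)),
              H ≤ Subgroup.zpowers θ → Nat.card H = 7 →
              ∀ g ∈ H, ∀ X ∈ MathonArcs.conics C,
                g '' X = X ∧ (g ≠ 1 → ∃ p ∈ X, g p ≠ p)) ∧
        ∀ G : Subgroup (Equiv.Perm (MathonArcs.Point K)),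
          MathonArcs.IsAutGroup G (MathonArcs.arc C) (MathonArcs.conics C) →
          ¬ MathonArcs.SharplyTransitive G (MathonArcs.conics C)) := by
  have := MathonArcs.charP_two K
  have hk₁ : 1 = 1 ∨ 1 = 3 := Or.inl rfl
  have hk₂ : 3 = 1 ∨ 3 = 3 := Or.inr rfl
  have hroot : ∀ a : K, 1 + a + a ^ 7 = 0 ↔ a ∈ MathonArcs.singerRoots K 1 := fun a => by
    simp [MathonArcs.singerRoots]
  refine ⟨?_, ?_, fun a b ha hb => ?_, fun a b ha hb => ?_, fun a b ha hb hab => ?_,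
    fun C hC => ?_⟩
  · obtain ⟨a, ha⟩ := MathonArcs.exists_mem_singerRoots hk₁ hcard h7
    exact ⟨a, MathonArcs.orderOf_eq hk₁ ha, (hroot a).2 ha⟩
  · obtain ⟨a, ha⟩ := MathonArcs.exists_mem_singerRoots hk₂ hcard h7
    exact ⟨a, MathonArcs.orderOf_eq hk₂ ha, ha⟩
  · obtain ⟨g, hg⟩ := MathonArcs.exists_isStdImage₁ ha
    obtain ⟨g', hg'⟩ := MathonArcs.exists_isStdImage₁ hb
    exact hg.isomorphic.symm.trans hg'.isomorphic
  · obtain ⟨g, hg⟩ := MathonArcs.exists_isStdImage₂ ha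
    obtain ⟨g', hg'⟩ := MathonArcs.exists_isStdImage₂ hb
    exact hg.isomorphic.symm.trans hg'.isomorphic
  · obtain ⟨g, hg⟩ := MathonArcs.exists_isStdImage₁ ha
    obtain ⟨g', hg'⟩ := MathonArcs.exists_isStdImage₂ hb
    exact MathonArcs.not_isomorphic_stdConics hcard hodd h7
      (hg'.isomorphic.trans (hab.symm.trans hg.isomorphic.symm))
  obtain ⟨k, hk, a, ha, g, hg⟩ : ∃ k, (k = 1 ∨ k = 3) ∧ ∃ a ∈ MathonArcs.singerRoots K k,
      ∃ g, MathonArcs.IsStdImage k g C := by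
    rcases hC with ⟨a, ha, rfl⟩ | ⟨a, ha, rfl⟩
    · exact ⟨1, hk₁, a, (hroot a).1 ha, MathonArcs.exists_isStdImage₁ ha⟩
    · exact ⟨3, hk₂, a, ha, MathonArcs.exists_isStdImage₂ ha⟩
  refine ⟨MathonArcs.isMathonArc_of_isStdImage hcard hodd hk ha hg, ?_, fun h49 => ?_,
    fun h49 => ⟨MathonArcs.exists_actsAsSquaring, fun τ hτ => ?_, fun G hG =>
      MathonArcs.not_sharplyTransitive hcard hodd h49 hk ha hg hG⟩⟩
  · rintro ⟨α, A, hα, hiso⟩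
    exact MathonArcs.not_isDennistonType_stdConics hcard hodd h7 hk
      ⟨α, A, hα, hiso.trans hg.isomorphic.symm⟩
  · obtain ⟨τ, hτ, hτ7⟩ := MathonArcs.exists_actsAsSquaring_orderOf_eq_seven hcard h7 h49
    obtain ⟨θ, hθ, hord, harc, hX⟩ := MathonArcs.exists_singer_generator hk hτ hg
    obtain ⟨haut, htrans⟩ := MathonArcs.isAutGroup_and_transitive hk hg hθ harc
      fun X hX' n => (hX X hX' n).1
    exact ⟨τ, hτ, hτ7, θ, hθ, hord.trans hτ7, haut,
      MathonArcs.sharplyTransitive_zpowers hcard hodd hk hg (hord.trans hτ7) htrans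
        fun X hX' n => (hX X hX' n).1⟩
  · have hdvd := MathonArcs.dvd_orderOf_of_actsAsSquaring hcard h49 hτ
    obtain ⟨θ, hθ, hord, harc, hX⟩ := MathonArcs.exists_singer_generator hk hτ hg
    obtain ⟨haut, htrans⟩ := MathonArcs.isAutGroup_and_transitive hk hg hθ harc
      fun X hX' n => (hX X hX' n).1
    have : Finite (MathonArcs.Point K) := Quotient.finite _
    rw [← hord] at hdvd
    exact ⟨hord ▸ hdvd, θ, hθ, haut, htrans,
      MathonArcs.existsUnique_subgroup_zpowers θ (by norm_num)
        ((by norm_num : 7 ∣ 49).trans hdvd),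
      fun H hH hH7 γ hγ S hS =>
        MathonArcs.fixes_conics_of_card_eq_seven hk hg hdvd hX hH hH7 hγ hS⟩
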